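/- **Conventions.** Let $G$ be a group acting transitively on a finite set $\Omega$. A *realization* of $(G,\Omega)$ is a $G$-equivariant map $A\colon\Omega\to V$ into a (finite-dimensional real) Euclidean space $V$ on which $G$ acts by orthogonal transformations. Its *dimension* is the dimension of the linear span of $A(\Omega)$, its *inner product matrix* is $(\langle A\xi,A\eta\rangle)_{\xi,\eta\in\Omega}$, and $A$ is *pure* if the linear span of $A(\Omega)$ is a simple $\mathbb RG$-module. Two realizations are *congruent* if a linear isometry defined on the linear span of the first carries the first to the second; pure realizations are considered up to congruence and positive scaling. The *realization cone* is the set of the inner product matrices of all realizations. Fix an initial vertex $\alpha\in\Omega$. The *layer* of $\xi\in\Omega$ is the set of all $\eta\in\Omega$ such that the unordered pairs $\{\alpha,\xi\}$ and $\{\alpha,\eta\}$ lie in the same $G$-orbit. The *cosine vector* of a pure realization $A$ has the entries $\langle A\alpha,A\xi\rangle/\langle A\alpha,A\alpha\rangle$ at the layers of the $\xi\in\Omega$. The *Wythoff space* of $A$ is the space of vectors in the linear span of $A(\Omega)$ fixed by the stabilizer of $\alpha$. $\operatorname{Irr}(U)$ and $\operatorname{Irr}_{\mathbb R}(U)$ are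 the sets of characters of the irreducible complex, respectively real, representations of a finite group $U$. **Theorem.** (a) Let $\Omega$ be the set of the $120$ vertices of the $600$-cell in $\mathbb H=\mathbb R^4$ (all even permutations of the coordinates of $(\pm1,0,0,0)$, $(\pm\frac12,\pm\frac12,\pm\frac12,\pm\frac12)$ and $\frac12(\pm\tau,\pm1,\pm\tau^{-1},0)$ with $\tau=\frac{1+\sqrt5}2$), let $G$ be the automorphism group of the $600$-cell, that is, its group of isometries, and let $\alpha=1$. There is a bijection $e\colon \mathrm{SL}(2,5)\to\Omega$ which is multiplicative (with respect to multiplication in $\mathbb H$) and maps the conjugacy classes of $\mathrm{SL}(2,5)$ bijectively to the layers of the $600$-cell, and there is a bijection $\phi\mapsto A_\phi$ between $\operatorname{Irr}(\mathrm{SL}(2,5))$ and the pure realizations of the $600$-cell, such that for all $\phi$ the realization $A_\phi$ has dimension $\phi(1)^2$, and its cosine vector has the entry $\phi(u)/\phi(1)$ at the layer corresponding to the conjugacy class of $u$, for every $u\in \mathrm{SL}(2,5)$. (b) More generally, let $U$ be any finite group, let $G=U\wr C_2$ be the wreath product, $H=C_2\times\operatorname{diag}(U)\le G$, let $\Omega=G/H$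 be the set of cosets with initial vertex $\alpha=H$. Write the elements of $G$ as $g=(x,y)s$ with $x,y\in U$, $s\in C_2$. 1. The layers correspond bijectively to the sets $C_u=u^U\cup(u^{-1})^U$ ($u\in U$), where $C_u$ corresponds to the layer of all $(x,y)s\alpha$ with $x^{-1}y\in C_u$. 2. The Wythoff space of every pure realization has dimension $1$. 3. There is a bijection $\sigma\mapsto A_\sigma$ from $\operatorname{Irr}_{\mathbb R}(U)$ to the pure realizations of $(G,\Omega)$ such that for every $\sigma$ and every constituent $\phi\in\operatorname{Irr}(U)$ of $\sigma$: the dimension of $A_\sigma$ is $\phi(1)^2$ if $\phi=\overline\phi$ and $2\phi(1)^2$ if $\phi\ne\overline\phi$; and for $g=(x,y)s\in G$ the cosine vector of $A_\sigma$ has the entry $\operatorname{Re}\phi(x^{-1}y)/\phi(1)$ at the layer of $g\alpha$. 4. The realization cone is the direct product of the rays $\mathbb R_{\ge0}Q_\sigma$, $\sigma\in\operatorname{Irr}_{\mathbb R}(U)$, where $Q_\sigma$ is the inner product matrix of $A_\sigma$: the $Q_\sigma$ are linearly independent, and the cone consists of their linear combinations with non-negative coefficients. -/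

import Mathlib

open scoped Quaternion InnerProductSpace

noncomputable section

/-! ### Characters -/

/-- Characters of the irreducible representations of the group `G` over the field `k`.
For `k = ℂ` this is `Irr G`, for `k = ℝ` it is `Irr_ℝ G`. -/
def IrrChar (k G : Type*) [Field k] [Group G] : Type _ :=
  {χ : G → k // ∃ (n : ℕ) (ρ : Representation k G (Fin n → k)),
    ρ.IsIrreducible ∧ ρ.character = χ}

/-- The function underlying an irreducible character. -/
def IrrChar.val {k G : Type*} [Field k] [Group G] (χ : IrrChar k G) : G → k := χ.1

instance {k G : Type*} [Field k] [Group G] : CoeFun (IrrChar k G) fun _ => G → k :=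
  ⟨IrrChar.val⟩

/-- The irreducible complex character `φ` is a constituent of the (complexified) irreducible real
character `σ`, that is, `[σ, φ] ≠ 0`. -/
def IsConstituent {G : Type*} [Group G] [Fintype G] (φ : IrrChar ℂ G) (σ : IrrChar ℝ G) : Prop :=
  (1 / (Fintype.card G : ℂ)) * ∑ g, (σ g : ℂ) * (starRingEnd ℂ) (φ g) ≠ 0

/-! ### Realizations -/

/-- A realization of the `G`-set `Ω`: a `G`-equivariant map from `Ω` into a Euclidean space `V` on
which `G` acts by orthogonal transformations. -/
structure Realization (G Ω : Type*) [Group G] [MulAction G Ω] where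
  V : Type
  [instNACG : NormedAddCommGroup V]
  [instIPS : InnerProductSpace ℝ V]
  [instFD : FiniteDimensional ℝ V]
  ρ : G →* (V ≃ₗᵢ[ℝ] V)
  toFun : Ω → V
  map_smul : ∀ (g : G) (ω : Ω), toFun (g • ω) = ρ g (toFun ω)

attribute [instance] Realization.instNACG Realization.instIPS Realization.instFD

namespace Realization

variable {G Ω : Type*} [Group G] [MulAction G Ω]

/-- The linear span of the points of a realization. -/
def linSpan (A : Realization G Ω) : Submodule ℝ A.V := Submodule.span ℝ (Set.range A.toFun)

/-- The dimension of a realization is the dimension of the linear span of its points. -/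
def dim (A : Realization G Ω) : ℕ := Module.finrank ℝ A.linSpan

/-- The inner product matrix of a realization. -/
def innerMatrix (A : Realization G Ω) : Matrix Ω Ω ℝ :=
  Matrix.of fun ξ η => ⟪A.toFun ξ, A.toFun η⟫_ℝ

/-- The entries of the cosine matrix of a realization; for fixed `α` and varying `ξ` they are the
entries of its cosine vector. -/
def cosine (A : Realization G Ω) (α ξ : Ω) : ℝ :=
  ⟪A.toFun α, A.toFun ξ⟫_ℝ / ⟪A.toFun α, A.toFun α⟫_ℝ

/-- A realization is pure if the linear span of its points is a simple `G`-module. -/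
def IsPure (A : Realization G Ω) : Prop :=
  A.linSpan ≠ ⊥ ∧
    ∀ W : Submodule ℝ A.V, W ≤ A.linSpan → (∀ (g : G), ∀ w ∈ W, A.ρ g w ∈ W) →
      W = ⊥ ∨ W = A.linSpan

/-- The Wythoff space: the vectors of the linear span of the realization that are fixed by the
stabilizer of the initial vertex `α`. -/
def wythoffSpace (A : Realization G Ω) (α : Ω) : Submodule ℝ A.V where
  carrier := {v | v ∈ A.linSpan ∧ ∀ g ∈ MulAction.stabilizer G α, A.ρ g v = v}
  add_mem' := fun ha hb => ⟨add_mem ha.1 hb.1, fun g hg => by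
    rw [_root_.map_add, ha.2 g hg, hb.2 g hg]⟩
  zero_mem' := ⟨zero_mem _, fun g _ => _root_.map_zero _⟩
  smul_mem' := fun c _ hv => ⟨Submodule.smul_mem _ c hv.1, fun g hg => by
    rw [_root_.map_smul, hv.2 g hg]⟩

/-- The realization `c A`. -/
def scale (c : ℝ) (A : Realization G Ω) : Realization G Ω where
  V := A.V
  ρ := A.ρ
  toFun := fun ω => c • A.toFun ω
  map_smul := fun g ω => by rw [A.map_smul, _root_.map_smul]

/-- Two realizations are congruent if a linear isometry from the linear span of the first one
carries the first one to the second one. -/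
def Congruent (A B : Realization G Ω) : Prop :=
  ∃ f : A.linSpan →ₗᵢ[ℝ] B.V,
    ∀ ω, f ⟨A.toFun ω, Submodule.subset_span (Set.mem_range_self ω)⟩ = B.toFun ω

/-- Two realizations are similar if they are congruent up to a positive scaling factor. -/
def Similar (A B : Realization G Ω) : Prop := ∃ c : ℝ, 0 < c ∧ Congruent (scale c A) B

theorem congruent_iff (A B : Realization G Ω) :
    Congruent A B ↔ ∀ ξ η, ⟪A.toFun ξ, A.toFun η⟫_ℝ = ⟪B.toFun ξ, B.toFun η⟫_ℝ := by
  constructor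
  · rintro ⟨f, hf⟩ ξ η
    rw [← hf, ← hf, f.inner_map_map]
    rfl
  · intro h
    let LA : (Ω →₀ ℝ) →ₗ[ℝ] A.V := Finsupp.linearCombination ℝ A.toFun
    let LB : (Ω →₀ ℝ) →ₗ[ℝ] B.V := Finsupp.linearCombination ℝ B.toFun
    have hin : ∀ c, ⟪LA c, LA c⟫_ℝ = ⟪LB c, LB c⟫_ℝ := by
      intro c
      simp only [LA, LB, Finsupp.linearCombination_apply, Finsupp.sum, sum_inner, inner_sum,
        inner_smul_left, inner_smul_right, h]
    have hn : ∀ c, ‖LB c‖ = ‖LA c‖ := by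
      intro c
      rw [norm_eq_sqrt_real_inner, norm_eq_sqrt_real_inner, hin]
    have hk : LinearMap.ker LA ≤ LinearMap.ker LB := by
      intro c hc
      rw [LinearMap.mem_ker] at hc ⊢
      rw [← norm_eq_zero, hn, hc, norm_zero]
    have hs : A.linSpan = LinearMap.range LA :=
      (Finsupp.range_linearCombination ℝ (v := A.toFun)).symm
    let F : LinearMap.range LA →ₗ[ℝ] B.V :=
      ((LinearMap.ker LA).liftQ LB hk).comp LA.quotKerEquivRange.symm.toLinearMap
    have hF : ∀ c, F ⟨LA c, LinearMap.mem_range_self LA c⟩ = LB c := by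
      intro c
      have : LA.quotKerEquivRange.symm ⟨LA c, LinearMap.mem_range_self LA c⟩ =
          (LinearMap.ker LA).mkQ c := by
        rw [LinearEquiv.symm_apply_eq]
        rfl
      simp only [F, LinearMap.comp_apply, LinearEquiv.coe_coe, this]
      rfl
    refine ⟨⟨F.comp (LinearEquiv.ofEq _ _ hs).toLinearMap, ?_⟩, ?_⟩
    · rintro ⟨x, hx⟩
      obtain ⟨c, rfl⟩ : x ∈ LinearMap.range LA := hs ▸ hx
      exact (congrArg norm (hF c)).trans (hn c)
    · intro ω
      have h1 : LA (Finsupp.single ω 1) = A.toFun ω := by simp [LA]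
      have h2 : LB (Finsupp.single ω 1) = B.toFun ω := by simp [LB]
      have := hF (Finsupp.single ω 1)
      rw [h2] at this
      rw [← this]
      change F _ = F _
      congr 1
      exact Subtype.ext h1.symm

theorem similar_iff (A B : Realization G Ω) :
    Similar A B ↔ ∃ c : ℝ, 0 < c ∧
      ∀ ξ η, c * (c * ⟪A.toFun ξ, A.toFun η⟫_ℝ) = ⟪B.toFun ξ, B.toFun η⟫_ℝ := by
  simp only [Similar, congruent_iff, scale, inner_smul_left, inner_smul_right]
  rfl

theorem similar_equivalence : Equivalence (Similar (G := G) (Ω := Ω)) where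
  refl := fun A => (similar_iff A A).2 ⟨1, one_pos, fun ξ η => by ring⟩
  symm := fun {A B} h => by
    obtain ⟨c, hc, h⟩ := (similar_iff A B).1 h
    refine (similar_iff B A).2 ⟨c⁻¹, inv_pos.2 hc, fun ξ η => ?_⟩
    rw [← h]
    field_simp
  trans := fun {A B C} h h' => by
    obtain ⟨c, hc, h⟩ := (similar_iff A B).1 h
    obtain ⟨d, hd, h'⟩ := (similar_iff B C).1 h'
    refine (similar_iff A C).2 ⟨d * c, mul_pos hd hc, fun ξ η => ?_⟩
    rw [← h', ← h]
    ring

end Realization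

/-- The pure realizations of the `G`-set `Ω`. -/
def PureRealization (G Ω : Type*) [Group G] [MulAction G Ω] : Type _ :=
  {A : Realization G Ω // A.IsPure}

/-- Similarity of pure realizations. -/
instance pureSetoid (G Ω : Type*) [Group G] [MulAction G Ω] : Setoid (PureRealization G Ω) where
  r := fun A B => A.1.Similar B.1
  iseqv := ⟨fun A => Realization.similar_equivalence.refl A.1,
    fun h => Realization.similar_equivalence.symm h,
    fun h h' => Realization.similar_equivalence.trans h h'⟩

/-- Pure realizations of the `G`-set `Ω`, up to congruence and positive scaling. -/
def PureClass (G Ω : Type*) [Group G] [MulAction G Ω] : Type _ :=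
  Quotient (pureSetoid G Ω)

/-- The class of a pure realization. -/
def PureRealization.toClass {G Ω : Type*} [Group G] [MulAction G Ω] (A : PureRealization G Ω) :
    PureClass G Ω :=
  Quotient.mk (pureSetoid G Ω) A

/-- The realization cone: the set of the inner product matrices of all realizations. -/
def realizationCone (G Ω : Type*) [Group G] [MulAction G Ω] : Set (Matrix Ω Ω ℝ) :=
  {Q | ∃ A : Realization G Ω, A.innerMatrix = Q}

/-- The layer of `ξ` with respect to the initial vertex `α`: all `η` such that the unordered pairs
`{α, ξ}` and `{α, η}` lie in the same `G`-orbit. -/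
def layer (G : Type*) {Ω : Type*} [Group G] [MulAction G Ω] (α ξ : Ω) : Set Ω :=
  {η | ∃ g : G, Sym2.map (fun ω => g • ω) s(α, ξ) = s(α, η)}

/-- The set of all layers with respect to `α`. -/
def layers (G : Type*) {Ω : Type*} [Group G] [MulAction G Ω] (α : Ω) : Set (Set Ω) :=
  Set.range (layer G α)

/-! ### The 600-cell -/

/-- The special linear group of degree two over the field with five elements. -/
abbrev SL25 : Type := Matrix.SpecialLinearGroup (Fin 2) (ZMod 5)

/-- The coordinates of a quaternion. -/
def quatCoord (q : ℍ) : Fin 4 → ℝ := ![q.re, q.imI, q.imJ, q.imK]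

/-- The 120 vertices of the 600-cell in `ℍ = ℝ⁴`: all even permutations of the coordinates of
`(±1, 0, 0, 0)`, `(±1/2, ±1/2, ±1/2, ±1/2)` and `(±τ/2, ±1/2, ±τ⁻¹/2, 0)`, where `τ` is the golden
ratio. -/
def cell600 : Set ℍ :=
  {q | ∃ s ∈ alternatingGroup (Fin 4),
    ∃ c ∈ ({![1, 0, 0, 0], ![1 / 2, 1 / 2, 1 / 2, 1 / 2],
      ![Real.goldenRatio / 2, 1 / 2, Real.goldenRatio⁻¹ / 2, 0]} : Set (Fin 4 → ℝ)),
      ∀ i, |quatCoord q (s i)| = c i}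

/-- The automorphism group of the 600-cell: all isometries of `ℍ = ℝ⁴` that permute its vertices.
(Such an isometry fixes the centre of the 600-cell, so it is linear.) -/
def cell600Group : Subgroup (ℍ ≃ₗᵢ[ℝ] ℍ) where
  carrier := {g | g '' cell600 = cell600}
  mul_mem' := fun {a b} ha hb => by
    change (fun x => a (b x)) '' cell600 = cell600
    rw [← Set.image_image a b, hb, ha]
  one_mem' := by
    change (fun x => x) '' cell600 = cell600
    exact Set.image_id' _
  inv_mem' := fun {a} ha => by
    change a.symm '' cell600 = cell600
    have ha' : a '' cell600 = cell600 := ha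
    conv_lhs => rw [← ha']
    rw [Set.image_image]
    simp

instance : MulAction cell600Group cell600 where
  smul := fun g x => ⟨g.1 x.1, by
    have h : g.1 '' cell600 = cell600 := g.2
    exact h.subset (Set.mem_image_of_mem _ x.2)⟩
  one_smul := fun _ => rfl
  mul_smul := fun _ _ _ => rfl

/-! ### The wreath product with a group of order two -/

/-- The group of order two. -/
abbrev C2 : Type := Multiplicative (ZMod 2)

/-- The generator of the group of order two. -/
abbrev C2.t : C2 := Multiplicative.ofAdd 1

/-- The subgroup `C₂ × diag(U)` of the wreath product `U ≀ C₂`. -/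
def diagC2 (U : Type*) [Group U] : Subgroup (U ≀ᵣ C2) where
  carrier := {g | g.left 1 = g.left C2.t}
  mul_mem' := fun {a b} ha hb => by
    have key : ∀ c : U ≀ᵣ C2, c.left 1 = c.left C2.t → ∀ i j, c.left i = c.left j := by
      intro c hc i j
      have h2 : ∀ k : C2, k = 1 ∨ k = C2.t := by decide
      rcases h2 i with rfl | rfl <;> rcases h2 j with rfl | rfl <;> simp [hc]
    simp only [Set.mem_ofPred_eq, RegularWreathProduct.mul_left, Pi.mul_apply]
    rw [key a ha 1 C2.t, key b hb _ (a.right⁻¹ * C2.t)]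
  one_mem' := rfl
  inv_mem' := fun {a} ha => by
    have key : ∀ c : U ≀ᵣ C2, c.left 1 = c.left C2.t → ∀ i j, c.left i = c.left j := by
      intro c hc i j
      have h2 : ∀ k : C2, k = 1 ∨ k = C2.t := by decide
      rcases h2 i with rfl | rfl <;> rcases h2 j with rfl | rfl <;> simp [hc]
    simp only [Set.mem_ofPred_eq, RegularWreathProduct.inv_left, Pi.inv_apply]
    rw [key a ha _ (a.right * C2.t)]

/-- The element `x⁻¹ y` for an element `(x, y) s` of `U ≀ C₂`, with `x, y ∈ U` and `s ∈ C₂`. -/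
def invMul {U : Type*} [Group U] (g : U ≀ᵣ C2) : U := (g.left 1)⁻¹ * g.left C2.t

/-- The union of the conjugacy classes of `u` and `u⁻¹`. -/
def symClass {U : Type*} [Group U] (u : U) : Set U := {v | IsConj u v ∨ IsConj u⁻¹ v}

end

/-! Both parts are instances of one statement about a bijection of a finite group `U` with `Ω` under
which the orbits of `G` on pairs are described exactly by the sets `symClass (u⁻¹ * v)`
(`IsGroupModel`). Then every `G`-invariant real kernel on `Ω` has the form `f (u⁻¹ * v)`, where `f`
is a class function invariant under inversion, and products of kernels become convolutions.

These functions form a commutative algebra. On an irreducible representation such an `f` acts by an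
operator commuting with the group. The endomorphism ring of a real irreducible module may be larger
than `ℝ`, but inversion invariance makes the operator self-adjoint for an invariant inner product.
Hence it has a real eigenvalue and is a scalar (`exists_funAction_eq_smul`). Together with
orthogonality and the regular representation this shows that the normalized real irreducible
characters `σ.idem` are orthogonal idempotents forming a basis.

The Gram kernel of a realization is therefore a combination of the `σ.idem`, with coefficients that
are non-negative because they are squared norms up to a positive factor. Purity means that a single
`σ` occurs. Conversely, the rows of the matrix of `σ.idem` have that matrix as Gram matrix, and a
trace computes the dimension as `|U| * σ.idem 1`. For a constituent `φ` of `σ`, `Re φ` is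
proportional to `σ`, which turns everything into values of `φ`.

For the wreath product, `U × U` acts on `U` by two-sided multiplication and the swap contributes
inversion. For the 600-cell, doubled vertices have coordinates in `ℤ[τ]`, and reduction modulo `√5`
identifies the vertices with `SL(2,5)`. Real parts of vertices separate conjugacy classes, so
isometries cannot merge more pairs than two-sided multiplications do; the full symmetry group need
not be determined. -/

noncomputable section

/-- Real-valued class functions that are invariant under inversion. -/
structure IsSymmClassFun {U : Type*} [Group U] (f : U → ℝ) : Prop where
  conj : ∀ g u, f (g * u * g⁻¹) = f u
  inv : ∀ u, f u⁻¹ = f u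

/-! ### Symmetric class functions act on irreducible representations as scalars -/

namespace Representation

/-- The eigenspace is a non-zero invariant subspace. This form of Schur's lemma needs one eigenvalue
in the field and no algebraic closedness, so it serves `ℝ` and `ℂ` alike. -/
theorem eq_smul_of_hasEigenvalue {k U V : Type*} [Field k] [Group U] [AddCommGroup V] [Module k V]
    (ρ : Representation k U V) [ρ.IsIrreducible]
    {T : Module.End k V} (hT : ∀ g x, T (ρ g x) = ρ g (T x)) {μ : k}
    (hμ : T.HasEigenvalue μ) : T = μ • LinearMap.id := by
  let W : Subrepresentation ρ := ⟨T.eigenspace μ, fun g v hv => by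
    rw [Module.End.mem_eigenspace_iff] at hv ⊢
    rw [hT, hv, map_smul]⟩
  rcases IsSimpleOrder.eq_bot_or_eq_top W with h | h
  · exact absurd (congrArg Subrepresentation.toSubmodule h) hμ
  · ext x
    have : x ∈ W.toSubmodule := by rw [h]; trivial
    exact Module.End.mem_eigenspace_iff.1 this

theorem IsIrreducible.nontrivial {k U V : Type*} [Field k] [Group U] [AddCommGroup V] [Module k V]
    (ρ : Representation k U V) [h : ρ.IsIrreducible] : Nontrivial V := by
  by_contra hV
  rw [not_nontrivial_iff_subsingleton] at hV
  obtain ⟨W, W', hW⟩ := h.exists_pair_ne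
  exact hW (Subrepresentation.toSubmodule_injective (Subsingleton.elim _ _))

section Unitary

variable {k U V : Type*} [RCLike k] [Group U] [Fintype U] [AddCommGroup V] [Module k V]

/-- The action of a real-valued function on `U`, seen as an element of the group algebra. -/
def funAction (ρ : Representation k U V) (f : U → ℝ) : V →ₗ[k] V := ∑ u, (f u : k) • ρ u

theorem funAction_apply (ρ : Representation k U V) (f : U → ℝ) (x : V) :
    funAction ρ f x = ∑ u, (f u : k) • ρ u x := by
  simp [funAction, LinearMap.sum_apply]

theorem funAction_comm (ρ : Representation k U V) {f : U → ℝ} (hf : IsSymmClassFun f) (g : U)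
    (x : V) : funAction ρ f (ρ g x) = ρ g (funAction ρ f x) := by
  rw [funAction_apply, funAction_apply]
  simp only [_root_.map_sum, map_smul, ← Module.End.mul_apply, ← map_mul]
  refine Fintype.sum_equiv (MulAut.conj g⁻¹).toEquiv _ _ fun u => ?_
  have : f (g⁻¹ * (u * g)) = f u := by simpa [mul_assoc] using hf.conj g⁻¹ u
  simp [this, mul_assoc]

theorem trace_funAction (ρ : Representation k U V) (f : U → ℝ) :
    LinearMap.trace k V (funAction ρ f) = ∑ u, (f u : k) * ρ.character u := by
  simp [funAction, character]

variable [FiniteDimensional k V]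

/-- An inner product on a finite-dimensional representation that is invariant under the group. -/
def invariantCore (ρ : Representation k U V) : InnerProductSpace.Core k V :=
  let b : V ≃ₗ[k] EuclideanSpace k (Fin (Module.finrank k V)) :=
    (Module.finBasis k V).equivFun.trans (WithLp.linearEquiv 2 k _).symm
  { inner := fun x y => ∑ g, inner k (b (ρ g x)) (b (ρ g y))
    conj_inner_symm := fun x y => by simp only [map_sum, inner_conj_symm]
    re_inner_nonneg := fun x => by
      rw [map_sum]
      exact Finset.sum_nonneg fun g _ => inner_self_nonneg
    add_left := fun x y z => by simp only [map_add, inner_add_left, Finset.sum_add_distrib]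
    smul_left := fun x y r => by simp only [map_smul, inner_smul_left, Finset.mul_sum]
    definite := fun x hx => by
      have h := congrArg RCLike.re hx
      rw [map_sum, map_zero, Finset.sum_eq_zero_iff_of_nonneg fun g _ => inner_self_nonneg] at h
      have h1 := h 1 (Finset.mem_univ _)
      rw [map_one, Module.End.one_apply, inner_self_eq_norm_sq, sq_eq_zero_iff, norm_eq_zero] at h1
      simpa using h1 }

theorem invariantCore_inner_apply (ρ : Representation k U V) (g : U) (x y : V) :
    (invariantCore ρ).inner (ρ g x) (ρ g y) = (invariantCore ρ).inner x y := by
  change Finset.sum _ _ = Finset.sum _ _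
  refine Fintype.sum_equiv (Equiv.mulRight g) _ _ fun h => ?_
  simp [map_mul]

/-- For an invariant inner product `ρ g⁻¹` is the adjoint of `ρ g`; compare the traces in an
orthonormal basis. -/
theorem character_inv_eq_conj (ρ : Representation k U V) (g : U) :
    ρ.character g⁻¹ = starRingEnd k (ρ.character g) := by
  let _ := (invariantCore ρ).toNormedAddCommGroup
  let _ := InnerProductSpace.ofCore (invariantCore ρ).toCore
  have hinv : ∀ x y : V, inner k (ρ g x) (ρ g y) = inner k x y := invariantCore_inner_apply ρ g
  let b := stdOrthonormalBasis k V
  rw [character, character, LinearMap.trace_eq_sum_inner _ b, LinearMap.trace_eq_sum_inner _ b,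
    map_sum]
  refine Finset.sum_congr rfl fun i _ => ?_
  rw [inner_conj_symm, ← hinv, ← Module.End.mul_apply, ← map_mul, mul_inv_cancel, map_one,
    Module.End.one_apply]

/-- The adjoint of `ρ u` is `ρ u⁻¹`, and the coefficients are real and invariant under inversion. -/
theorem funAction_isSymmetric {E : Type*} [NormedAddCommGroup E] [InnerProductSpace k E]
    (ρ : Representation k U E) (hρ : ∀ g x y, inner k (ρ g x) (ρ g y) = inner k x y)
    {f : U → ℝ} (hf : IsSymmClassFun f) : (∑ u, (f u : k) • ρ u).IsSymmetric := by
  intro x y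
  simp only [LinearMap.sum_apply, LinearMap.smul_apply, sum_inner, inner_sum, inner_smul_left,
    inner_smul_right, RCLike.conj_ofReal]
  refine Fintype.sum_equiv (Equiv.inv U) _ _ fun u => ?_
  rw [Equiv.inv_apply, hf.inv, ← hρ u x, ← Module.End.mul_apply (ρ u), ← map_mul,
    mul_inv_cancel, map_one, Module.End.one_apply]

/-- Symmetric class functions act on irreducible representations as real scalars. -/
theorem exists_funAction_eq_smul (ρ : Representation k U V) [ρ.IsIrreducible] {f : U → ℝ}
    (hf : IsSymmClassFun f) : ∃ μ : ℝ, funAction ρ f = (μ : k) • LinearMap.id := by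
  let _ := (invariantCore ρ).toNormedAddCommGroup
  let _ := InnerProductSpace.ofCore (invariantCore ρ).toCore
  have hinv : ∀ g (x y : V), inner k (ρ g x) (ρ g y) = inner k x y := invariantCore_inner_apply ρ
  have := IsIrreducible.nontrivial ρ
  -- The eigenvalue is the supremum of the Rayleigh quotient, hence real also over `ℂ`.
  exact ⟨_, eq_smul_of_hasEigenvalue ρ (funAction_comm ρ hf)
    (funAction_isSymmetric ρ hinv hf).hasEigenvalue_iSup_of_finiteDimensional⟩

/-- Multiply the scalar operator by `ρ u` and take traces: the character is an eigenfunction of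
convolution with `f`. -/
theorem exists_sum_mul_character (ρ : Representation k U V) [ρ.IsIrreducible] {f : U → ℝ}
    (hf : IsSymmClassFun f) : ∃ μ : ℝ, (∑ u, (f u : k) * ρ.character u = μ * ρ.character 1) ∧
      ∀ u, ∑ v, (f v : k) * ρ.character (v⁻¹ * u) = μ * ρ.character u := by
  obtain ⟨μ, hμ⟩ := exists_funAction_eq_smul ρ hf
  have key : ∀ u, ∑ v, (f v : k) * ρ.character (v * u) = μ * ρ.character u := by
    intro u
    have h := congrArg (fun T => LinearMap.trace k V (T * ρ u)) hμ
    simpa [funAction, Finset.sum_mul, character, map_mul, Module.End.mul_eq_comp] using h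
  refine ⟨μ, by simpa using key 1, fun u => ?_⟩
  rw [← key u]
  refine Fintype.sum_equiv (Equiv.inv U) _ _ fun v => ?_
  simp [hf.inv]

end Unitary

section Irreducible

variable {k U V : Type*} [Field k] [Group U] [AddCommGroup V] [Module k V] [FiniteDimensional k V]

/-- A non-zero invariant subspace contains an irreducible one. -/
theorem exists_irreducible_le (ρ : Representation k U V) (R : Subrepresentation ρ) (hR : R ≠ ⊥) :
    ∃ W : Subrepresentation ρ, W.toSubmodule ≤ R.toSubmodule ∧ W.toRepresentation.IsIrreducible := by
  classical
  -- A non-zero invariant subspace of least dimension inside `R` is irreducible.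
  have hex : ∃ n, ∃ W : Subrepresentation ρ, W.toSubmodule ≤ R.toSubmodule ∧ W.toSubmodule ≠ ⊥ ∧
      Module.finrank k W.toSubmodule = n :=
    ⟨_, R, le_rfl, fun h => hR (Subrepresentation.toSubmodule_injective h), rfl⟩
  obtain ⟨W, hWR, hW, hn⟩ := Nat.find_spec hex
  refine ⟨W, hWR, ?_⟩
  have : Nontrivial (Subrepresentation W.toRepresentation) := by
    refine ⟨⊥, ⊤, fun h => hW ?_⟩
    have h' := congrArg Subrepresentation.toSubmodule h
    have h'' : (⊥ : Submodule k W.toSubmodule) = ⊤ := h'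
    rw [Submodule.eq_bot_iff]
    intro x hx
    have : (⟨x, hx⟩ : W.toSubmodule) ∈ (⊥ : Submodule k W.toSubmodule) := h'' ▸ Submodule.mem_top
    exact congrArg Subtype.val ((Submodule.mem_bot k).1 this)
  refine ⟨fun X => ?_⟩
  by_cases hX : X.toSubmodule = ⊥
  · exact Or.inl (Subrepresentation.toSubmodule_injective hX)
  right
  let Y : Subrepresentation ρ := ⟨X.toSubmodule.map W.toSubmodule.subtype, by
    rintro g _ ⟨v, hv, rfl⟩
    exact ⟨W.toRepresentation g v, X.apply_mem_toSubmodule g hv, rfl⟩⟩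
  have hYW : Y.toSubmodule ≤ W.toSubmodule := Submodule.map_subtype_le _ _
  have hY : Y.toSubmodule ≠ ⊥ := fun h => hX (by
    rw [Submodule.eq_bot_iff]
    intro x hx
    have : (x : V) ∈ Y.toSubmodule := ⟨x, hx, rfl⟩
    rw [h, Submodule.mem_bot] at this
    exact Subtype.ext this)
  have hle := Nat.find_min' hex ⟨Y, hYW.trans hWR, hY, rfl⟩
  rw [← hn] at hle
  have heq : Y.toSubmodule = W.toSubmodule := Submodule.eq_of_le_of_finrank_le hYW hle
  refine Subrepresentation.toSubmodule_injective ?_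
  change X.toSubmodule = ⊤
  rw [Submodule.eq_top_iff']
  intro x
  have hx : (x : V) ∈ Y.toSubmodule := by rw [heq]; exact x.2
  obtain ⟨y, hy, hyx⟩ := hx
  rwa [← Subtype.ext hyx]

/-- The character of any finite-dimensional irreducible representation is an element of
`IrrChar`. -/
theorem exists_irrChar (ρ : Representation k U V) [h : ρ.IsIrreducible] :
    ∃ χ : IrrChar k U, ∀ u, χ u = ρ.character u := by
  let b : V ≃ₗ[k] (Fin (Module.finrank k V) → k) := (Module.finBasis k V).equivFun
  let ρ' : Representation k U (Fin (Module.finrank k V) → k) :=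
    (b.conjRingEquiv : Module.End k V →* _).comp ρ
  have hρ' : ∀ g x, ρ' g x = b (ρ g (b.symm x)) := fun g x => rfl
  let i : Subrepresentation ρ' ≃o Subrepresentation ρ :=
    { toFun := fun W => ⟨W.toSubmodule.comap b.toLinearMap, fun g v hv => by
        have := W.apply_mem_toSubmodule g hv
        rw [hρ'] at this
        simpa using this⟩
      invFun := fun W => ⟨W.toSubmodule.comap b.symm.toLinearMap, fun g v hv => by
        have := W.apply_mem_toSubmodule g hv
        simpa [hρ'] using this⟩
      left_inv := fun W => Subrepresentation.toSubmodule_injective (by ext; simp)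
      right_inv := fun W => Subrepresentation.toSubmodule_injective (by ext; simp)
      map_rel_iff' := by
        intro W W'
        constructor
        · intro hle x hx
          have h : b (b.symm x) ∈ W.toSubmodule := by rwa [b.apply_symm_apply]
          have h' : b (b.symm x) ∈ W'.toSubmodule := hle h
          rwa [b.apply_symm_apply] at h'
        · intro hle x hx
          exact hle hx }
  have : ρ'.IsIrreducible := i.isSimpleOrder_iff.2 h
  refine ⟨⟨ρ'.character, _, ρ', this, rfl⟩, fun u => ?_⟩
  exact LinearMap.trace_conj' (ρ u) b

end Irreducible

end Representation

/-! ### Orthogonality and separation by irreducible characters -/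

namespace IrrChar

section Field

variable {k U : Type*} [Field k] [Group U]

theorem one_eq_natCast (χ : IrrChar k U) : ∃ n : ℕ, 0 < n ∧ χ 1 = n := by
  obtain ⟨n, ρ, hρ, h⟩ := χ.2
  have := Representation.IsIrreducible.nontrivial ρ
  refine ⟨Module.finrank k (Fin n → k), Module.finrank_pos, ?_⟩
  change χ.1 1 = _
  rw [← h, Representation.char_one]

theorem one_ne_zero [CharZero k] (χ : IrrChar k U) : χ 1 ≠ 0 := by
  obtain ⟨n, hn, h⟩ := χ.one_eq_natCast
  rw [h]
  exact_mod_cast hn.ne'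

theorem conj_apply (χ : IrrChar k U) (g u : U) : χ (g * u * g⁻¹) = χ u := by
  obtain ⟨n, ρ, -, h⟩ := χ.2
  change χ.1 _ = χ.1 _
  rw [← h, Representation.char_conj]

theorem ext {χ ψ : IrrChar k U} (h : ∀ u, χ u = ψ u) : χ = ψ := Subtype.ext (funext h)

/-- The sum is, up to `|U|`, the dimension of a space of intertwiners. Only its vanishing is needed,
so no algebraic closedness enters. -/
theorem sum_mul_inv_eq_zero [CharZero k] [Fintype U] {χ ψ : IrrChar k U} (hne : χ ≠ ψ) :
    ∑ u, χ u * ψ u⁻¹ = 0 := by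
  obtain ⟨n, ρ, hρ, h⟩ := χ.2
  obtain ⟨m, ρ', hρ', h'⟩ := ψ.2
  have hcard : (Nat.card U : k) ≠ 0 := by exact_mod_cast Nat.card_pos.ne'
  let _ : Invertible (Nat.card U : k) := invertibleOfNonzero hcard
  have hE : IsEmpty (Representation.Equiv ρ' ρ) :=
    ⟨fun i => hne (Subtype.ext (by rw [← h, ← h', Representation.char_iso i]))⟩
  have key := Representation.card_inv_mul_sum_char_mul_char_eq_finrank ρ' ρ
  rw [Module.finrank_zero_of_subsingleton, Nat.cast_zero, mul_eq_zero] at key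
  have := key.resolve_left (inv_ne_zero hcard)
  rw [h, h'] at this
  exact this

end Field

section RCLike

variable {k U : Type*} [RCLike k] [Group U] [Fintype U]

theorem inv_apply (χ : IrrChar k U) (u : U) : χ u⁻¹ = starRingEnd k (χ u) := by
  obtain ⟨n, ρ, -, h⟩ := χ.2
  change χ.1 _ = starRingEnd k (χ.1 _)
  rw [← h, Representation.character_inv_eq_conj]

theorem exists_sum_mul (χ : IrrChar k U) {f : U → ℝ} (hf : IsSymmClassFun f) :
    ∃ μ : ℝ, (∑ u, (f u : k) * χ u = μ * χ 1) ∧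
      ∀ u, ∑ v, (f v : k) * χ (v⁻¹ * u) = μ * χ u := by
  obtain ⟨n, ρ, hρ, h⟩ := χ.2
  have := Representation.exists_sum_mul_character ρ hf
  rw [h] at this
  exact this

/-- The irreducible characters separate the symmetric class functions. -/
theorem exists_sum_mul_ne_zero (k : Type*) [RCLike k] {f : U → ℝ} (hf : IsSymmClassFun f)
    (h0 : f ≠ 0) : ∃ χ : IrrChar k U, ∑ u, (f u : k) * χ u ≠ 0 := by
  classical
  -- The left regular representation, by isometries; `f` then acts by the self-adjoint operator `T`.
  let L : U → EuclideanSpace k U ≃ₗᵢ[k] EuclideanSpace k U := fun g =>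
    LinearIsometryEquiv.piLpCongrLeft 2 k k (Equiv.mulLeft g)
  have hL : ∀ g x h, L g x h = x (g⁻¹ * h) := fun g x h => by
    simp [L, LinearIsometryEquiv.piLpCongrLeft_apply, Equiv.piCongrLeft']
  let ρ : Representation k U (EuclideanSpace k U) :=
    { toFun := fun g => (L g).toLinearEquiv.toLinearMap
      map_one' := by
        ext x h
        exact (hL 1 x h).trans (by simp)
      map_mul' := fun a b => by
        ext x h
        refine (hL (a * b) x h).trans ?_
        refine Eq.trans ?_ (hL a (L b x) h).symm
        rw [hL, mul_inv_rev, mul_assoc] }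
  have hρ : ∀ g x, ρ g x = L g x := fun _ _ => rfl
  have hT := Representation.funAction_isSymmetric ρ (fun g x y => (L g).inner_map_map x y) hf
  set T : EuclideanSpace k U →ₗ[k] EuclideanSpace k U := ∑ u, (f u : k) • ρ u with hTdef
  have hTf : T = Representation.funAction ρ f := rfl
  -- `T` maps the indicator of `1` to `f`, which is not zero.
  have hT0 : LinearMap.range T ≠ ⊥ := by
    intro hr
    rw [LinearMap.range_eq_bot] at hr
    refine h0 (funext fun u => ?_)
    have h1 := congrArg (fun S => (S (EuclideanSpace.single 1 1) : EuclideanSpace k U) u) hr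
    simp only [hTdef, LinearMap.sum_apply, LinearMap.smul_apply, hρ, PiLp.smul_apply, hL,
      LinearMap.zero_apply, PiLp.zero_apply, WithLp.ofLp_sum, Finset.sum_apply] at h1
    rw [Finset.sum_eq_single u] at h1
    · simpa using h1
    · intro v _ hv
      have : v⁻¹ * u ≠ 1 := fun h => hv (by rw [inv_mul_eq_one] at h; exact h)
      simp [this]
    · simp
  obtain ⟨W, hWR, hW⟩ := Representation.exists_irreducible_le ρ
    ⟨LinearMap.range T, by
      rintro g _ ⟨x, rfl⟩
      exact ⟨ρ g x, Representation.funAction_comm ρ hf g x⟩⟩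
    (fun h => hT0 (congrArg Subrepresentation.toSubmodule h))
  obtain ⟨χ, hχ⟩ := Representation.exists_irrChar W.toRepresentation
  have hWT : ∀ v ∈ W.toSubmodule, T v ∈ W.toSubmodule := fun v hv => by
    rw [hTf, Representation.funAction_apply]
    exact Submodule.sum_mem _ fun u _ => W.toSubmodule.smul_mem _ (W.apply_mem_toSubmodule u hv)
  have hres : Representation.funAction W.toRepresentation f = T.restrict hWT := by
    ext x : 1
    refine Subtype.ext ?_
    rw [Representation.funAction_apply, LinearMap.coe_restrict_apply, hTf,
      Representation.funAction_apply]
    simp [Subrepresentation.toRepresentation]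
  obtain ⟨μ, hμ⟩ := Representation.exists_funAction_eq_smul W.toRepresentation hf
  have hnt := Representation.IsIrreducible.nontrivial W.toRepresentation
  refine ⟨χ, fun h => ?_⟩
  have h2 := Representation.trace_funAction W.toRepresentation f
  simp only [← hχ] at h2
  rw [h, hμ, map_smul, LinearMap.trace_id, smul_eq_mul, mul_eq_zero] at h2
  have hμ0 : (μ : k) = 0 := h2.resolve_right (by exact_mod_cast Module.finrank_pos.ne')
  obtain ⟨x, hx⟩ := exists_ne (0 : W.toSubmodule)
  have hTx : T x = 0 := by
    have := congrArg (fun S => ((S x : W.toSubmodule) : EuclideanSpace k U)) (hres.symm.trans hμ)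
    simpa [hμ0] using this
  -- The scalar vanishes, so `T` kills `W`. But `x = T y` lies in the range, and self-adjointness
  -- gives `⟪x, x⟫ = ⟪y, T x⟫ = 0`.
  obtain ⟨y, hy⟩ := hWR x.2
  refine hx (Subtype.ext ?_)
  rw [Submodule.coe_zero, ← inner_self_eq_zero (𝕜 := k)]
  nth_rw 1 [← hy]
  rw [hT, hTx, inner_zero_right]

end RCLike

end IrrChar

/-! ### Convolution of symmetric class functions -/

variable {U : Type*} [Group U] [Fintype U]

/-- Convolution of functions on a finite group. -/
def conv (f h : U → ℝ) (u : U) : ℝ := ∑ v, f v * h (v⁻¹ * u)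

theorem conv_smul_right (c : ℝ) (f h : U → ℝ) : conv f (c • h) = c • conv f h := by
  ext u
  simp only [conv, Pi.smul_apply, smul_eq_mul, Finset.mul_sum]
  exact Finset.sum_congr rfl fun v _ => by ring

theorem conv_smul_left (c : ℝ) (f h : U → ℝ) : conv (c • f) h = c • conv f h := by
  ext u
  simp only [conv, Pi.smul_apply, smul_eq_mul, Finset.mul_sum]
  exact Finset.sum_congr rfl fun v _ => by ring

theorem conv_sub_right (f h h' : U → ℝ) : conv f (h - h') = conv f h - conv f h' := by
  ext u
  simp only [conv, Pi.sub_apply, mul_sub, Finset.sum_sub_distrib]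

theorem conv_sum_right {ι : Type*} (s : Finset ι) (f : U → ℝ) (h : ι → U → ℝ) :
    conv f (∑ i ∈ s, h i) = ∑ i ∈ s, conv f (h i) := by
  ext u
  simp only [conv, Finset.sum_apply, Finset.mul_sum]
  exact Finset.sum_comm

theorem conv_sum_left {ι : Type*} (s : Finset ι) (f : ι → U → ℝ) (h : U → ℝ) :
    conv (∑ i ∈ s, f i) h = ∑ i ∈ s, conv (f i) h := by
  ext u
  simp only [conv, Finset.sum_apply, Finset.sum_mul]
  exact Finset.sum_comm

namespace IsSymmClassFun

omit [Fintype U] in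
theorem mul_comm {f : U → ℝ} (hf : IsSymmClassFun f) (u v : U) : f (u * v) = f (v * u) := by
  simpa [mul_assoc] using (hf.conj v (u * v)).symm

theorem conv_comm {f h : U → ℝ} (hh : IsSymmClassFun h) :
    conv f h = conv h f := by
  ext u
  refine Fintype.sum_equiv ((Equiv.inv U).trans (Equiv.mulLeft u)) _ _ fun v => ?_
  simp [hh.mul_comm v⁻¹ u, _root_.mul_comm (f v)]

omit [Fintype U] in
theorem smul {f : U → ℝ} (hf : IsSymmClassFun f) (c : ℝ) : IsSymmClassFun (c • f) :=
  ⟨fun g u => by simp [hf.conj], fun u => by simp [hf.inv]⟩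

omit [Fintype U] in
theorem sub {f h : U → ℝ} (hf : IsSymmClassFun f) (hh : IsSymmClassFun h) :
    IsSymmClassFun (f - h) :=
  ⟨fun g u => by simp [hf.conj, hh.conj], fun u => by simp [hf.inv, hh.inv]⟩

omit [Fintype U] in
theorem sum {ι : Type*} (s : Finset ι) {f : ι → U → ℝ} (hf : ∀ i, IsSymmClassFun (f i)) :
    IsSymmClassFun (∑ i ∈ s, f i) :=
  ⟨fun g u => by simp [(hf _).conj], fun u => by simp [(hf _).inv]⟩

end IsSymmClassFun

/-! ### Central idempotents of the real irreducible characters -/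

namespace IrrChar

omit [Fintype U] in
theorem one_pos (σ : IrrChar ℝ U) : 0 < σ 1 := by
  obtain ⟨n, hn, h⟩ := σ.one_eq_natCast
  rw [h]
  exact_mod_cast hn

theorem isSymmClassFun (σ : IrrChar ℝ U) : IsSymmClassFun σ :=
  ⟨σ.conj_apply, σ.inv_apply⟩

theorem isSymmClassFun_re (φ : IrrChar ℂ U) : IsSymmClassFun fun u => (φ u).re :=
  ⟨fun g u => by rw [φ.conj_apply], fun u => by rw [φ.inv_apply, Complex.conj_re]⟩

/-- The sum of the squares of the values of a real character. -/
def normSq (σ : IrrChar ℝ U) : ℝ := ∑ u, σ u * σ u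

theorem normSq_pos (σ : IrrChar ℝ U) : 0 < σ.normSq :=
  Finset.sum_pos' (fun _ _ => mul_self_nonneg _) ⟨1, Finset.mem_univ _, mul_pos σ.one_pos σ.one_pos⟩

/-- The factor is the scalar by which `f` acts, read off at the identity. -/
theorem conv_eq_smul {f : U → ℝ} (hf : IsSymmClassFun f) (σ : IrrChar ℝ U) :
    conv f σ = ((∑ u, f u * σ u) / σ 1) • ⇑σ := by
  obtain ⟨μ, h1, h2⟩ := σ.exists_sum_mul hf
  simp only [RCLike.ofReal_real_eq_id, id] at h1 h2
  ext u
  rw [h1, mul_div_cancel_right₀ _ σ.one_pos.ne']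
  exact h2 u

/-- The central idempotent belonging to a real irreducible character. -/
def idem (σ : IrrChar ℝ U) : U → ℝ := (σ 1 / σ.normSq) • ⇑σ

theorem idem_isSymmClassFun (σ : IrrChar ℝ U) : IsSymmClassFun σ.idem := σ.isSymmClassFun.smul _

theorem idem_one_pos (σ : IrrChar ℝ U) : 0 < σ.idem 1 :=
  mul_pos (div_pos σ.one_pos σ.normSq_pos) σ.one_pos

theorem idem_div_idem_one (σ : IrrChar ℝ U) (u : U) : σ.idem u / σ.idem 1 = σ u / σ 1 :=
  mul_div_mul_left _ _ (div_pos σ.one_pos σ.normSq_pos).ne'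

theorem exists_conv_idem {f : U → ℝ} (hf : IsSymmClassFun f) (σ : IrrChar ℝ U) :
    ∃ c : ℝ, conv σ.idem f = c • σ.idem := by
  refine ⟨(∑ u, f u * σ u) / σ 1, ?_⟩
  rw [hf.conv_comm, idem, conv_smul_right, conv_eq_smul hf, smul_comm]

/-- Since `σ * σ` is `normSq / σ 1` times `σ`, the normalization of `idem` is forced. It uses
`normSq` instead of `|U|` because a real irreducible character need not have norm one. -/
theorem conv_idem_self (σ : IrrChar ℝ U) : conv σ.idem σ.idem = σ.idem := by
  rw [idem, conv_smul_right, conv_smul_left, conv_eq_smul σ.isSymmClassFun, smul_smul, smul_smul]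
  congr 1
  rw [← normSq]
  have := σ.normSq_pos.ne'
  have := σ.one_pos.ne'
  field_simp

theorem conv_idem_of_ne {σ τ : IrrChar ℝ U} (h : σ ≠ τ) : conv σ.idem τ.idem = 0 := by
  have := sum_mul_inv_eq_zero h
  simp only [τ.isSymmClassFun.inv] at this
  rw [idem, idem, conv_smul_right, conv_smul_left, conv_eq_smul σ.isSymmClassFun, this, zero_div,
    zero_smul, smul_zero, smul_zero]

/-- At the identity `conv σ.idem f` is a non-zero multiple of `∑ f σ`, and characters separate
symmetric class functions. -/
theorem eq_zero_of_conv_idem {f : U → ℝ} (hf : IsSymmClassFun f)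
    (h : ∀ σ : IrrChar ℝ U, conv σ.idem f = 0) : f = 0 := by
  by_contra h0
  obtain ⟨σ, hσ⟩ := exists_sum_mul_ne_zero ℝ hf h0
  have h1 := congrFun (h σ) 1
  rw [hf.conv_comm, idem, conv_smul_right, conv_eq_smul hf] at h1
  simp only [Pi.smul_apply, smul_eq_mul, Pi.zero_apply] at h1
  have := σ.one_pos.ne'
  have := σ.normSq_pos.ne'
  simp only [RCLike.ofReal_real_eq_id, id] at hσ
  simp_all

theorem conv_idem_sum [DecidableEq (IrrChar ℝ U)] (s : Finset (IrrChar ℝ U))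
    (c : IrrChar ℝ U → ℝ) (σ : IrrChar ℝ U) :
    conv σ.idem (∑ τ ∈ s, c τ • τ.idem) = if σ ∈ s then c σ • σ.idem else 0 := by
  rw [conv_sum_right]
  split_ifs with h
  · rw [Finset.sum_eq_single_of_mem σ h, conv_smul_right, conv_idem_self]
    intro τ _ hτ
    rw [conv_smul_right, conv_idem_of_ne hτ.symm, smul_zero]
  · refine Finset.sum_eq_zero fun τ hτ => ?_
    rw [conv_smul_right, conv_idem_of_ne (fun e : σ = τ => h (e ▸ hτ)), smul_zero]

theorem idem_ne_zero (σ : IrrChar ℝ U) : σ.idem ≠ 0 := fun h =>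
  σ.idem_one_pos.ne' (congrFun h 1)

/-- Convolution with `σ.idem` extracts the coefficient at `σ`. Independence in the
finite-dimensional space of functions on `U` also yields the finiteness of the set of real
characters. -/
theorem linearIndependent_idem : LinearIndependent ℝ (idem (U := U)) := by
  classical
  rw [linearIndependent_iff']
  intro s c h σ hσ
  have := conv_idem_sum s c σ
  rw [h, if_pos hσ] at this
  have h0 : conv σ.idem (0 : U → ℝ) = 0 := by ext; simp [conv]
  rw [h0] at this
  exact (smul_eq_zero.1 this.symm).resolve_right σ.idem_ne_zero

instance : Finite (IrrChar ℝ U) := (linearIndependent_idem (U := U)).finite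

instance : Fintype (IrrChar ℝ U) := Fintype.ofFinite _

/-- The irreducible real characters span the symmetric class functions. -/
theorem eq_sum_smul_idem {f : U → ℝ} (hf : IsSymmClassFun f) {c : IrrChar ℝ U → ℝ}
    (hc : ∀ σ : IrrChar ℝ U, conv σ.idem f = c σ • σ.idem) : f = ∑ σ, c σ • σ.idem := by
  classical
  rw [← sub_eq_zero]
  refine eq_zero_of_conv_idem
    (hf.sub (IsSymmClassFun.sum _ fun σ => σ.idem_isSymmClassFun.smul _)) fun σ => ?_
  rw [conv_sub_right, conv_idem_sum, if_pos (Finset.mem_univ _), hc, sub_self]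

end IrrChar

/-! ### Real and complex irreducible characters -/

theorem Representation.IsIrreducible.dual {k U V : Type*} [Field k] [Group U] [AddCommGroup V]
    [Module k V] [FiniteDimensional k V] (ρ : Representation k U V) [ρ.IsIrreducible] :
    ρ.dual.IsIrreducible := by
  have := IsIrreducible.nontrivial ρ
  have : Nontrivial (Subrepresentation ρ.dual) := by
    refine ⟨⊥, ⊤, fun h => ?_⟩
    have h' : (⊥ : Submodule k (Module.Dual k V)) = ⊤ := congrArg Subrepresentation.toSubmodule h
    exact bot_ne_top h'
  refine ⟨fun W => ?_⟩
  -- Passing to annihilators reverses inclusions between invariant subspaces of the module and of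
  -- its dual.
  let X : Subrepresentation ρ := ⟨W.toSubmodule.dualCoannihilator, fun g v hv => by
    rw [Submodule.mem_dualCoannihilator] at hv ⊢
    intro φ hφ
    have := hv _ (W.apply_mem_toSubmodule g⁻¹ hφ)
    rw [Representation.dual_apply, inv_inv] at this
    exact this⟩
  have hX : X.toSubmodule.dualAnnihilator = W.toSubmodule :=
    Subspace.dualCoannihilator_dualAnnihilator_eq
  rcases IsSimpleOrder.eq_bot_or_eq_top X with h | h
  · right
    refine Subrepresentation.toSubmodule_injective ?_
    rw [← hX, h]
    exact Submodule.dualAnnihilator_bot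
  · left
    refine Subrepresentation.toSubmodule_injective ?_
    rw [← hX, h]
    exact Submodule.dualAnnihilator_top

namespace IrrChar

variable {U : Type*} [Group U]

theorem exists_conj [Fintype U] (φ : IrrChar ℂ U) :
    ∃ ψ : IrrChar ℂ U, ∀ u, ψ u = starRingEnd ℂ (φ u) := by
  obtain ⟨n, ρ, hρ, h⟩ := φ.2
  have := Representation.IsIrreducible.dual ρ
  obtain ⟨ψ, hψ⟩ := Representation.exists_irrChar ρ.dual
  refine ⟨ψ, fun u => ?_⟩
  rw [hψ, Representation.char_dual, ← φ.inv_apply]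
  exact congrFun h _

theorem sum_mul_conj [Fintype U] (φ : IrrChar ℂ U) :
    ∑ u, φ u * starRingEnd ℂ (φ u) = Fintype.card U := by
  obtain ⟨n, ρ, hρ, h⟩ := φ.2
  have hcard : (Nat.card U : ℂ) ≠ 0 := by exact_mod_cast Nat.card_pos.ne'
  let _ : Invertible (Nat.card U : ℂ) := invertibleOfNonzero hcard
  have key := Representation.char_orthonormal ρ ρ
  rw [if_pos ⟨Representation.Equiv.refl ρ⟩, inv_mul_eq_one₀ hcard, h] at key
  simp only [← φ.inv_apply, ← Nat.card_eq_fintype_card]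
  exact key.symm

/-- If the characters were distinct, proportionality would turn their orthogonality into `∑ ‖χ u‖ ^
2 = 0`. -/
theorem eq_of_proportional {k : Type*} [RCLike k] [Fintype U] {χ ψ : IrrChar k U}
    (h : ∀ u, χ u * ψ 1 = ψ u * χ 1) : χ = ψ := by
  by_contra hne
  have h0 := sum_mul_inv_eq_zero hne
  have h1 : ∑ u, χ u * starRingEnd k (χ u) = 0 := by
    have : ∑ u, (χ u * χ u⁻¹) * ψ 1 = (∑ u, χ u * ψ u⁻¹) * χ 1 := by
      rw [Finset.sum_mul]
      exact Finset.sum_congr rfl fun u _ => by rw [mul_assoc, h, mul_assoc]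
    rw [h0, zero_mul, ← Finset.sum_mul, mul_eq_zero] at this
    simpa only [χ.inv_apply] using this.resolve_right ψ.one_ne_zero
  simp only [RCLike.mul_conj] at h1
  have h2 : ∑ u, ‖χ u‖ ^ 2 = 0 := by exact_mod_cast h1
  rw [Finset.sum_eq_zero_iff_of_nonneg fun u _ => sq_nonneg _] at h2
  exact χ.one_ne_zero (by simpa using h2 1 (Finset.mem_univ _))

theorem ofReal_re_one (φ : IrrChar ℂ U) : (((φ 1).re : ℝ) : ℂ) = φ 1 := by
  obtain ⟨n, -, h⟩ := φ.one_eq_natCast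
  rw [h]
  simp

theorem re_one_pos (φ : IrrChar ℂ U) : 0 < (φ 1).re := by
  obtain ⟨n, hn, h⟩ := φ.one_eq_natCast
  rw [h]
  simpa using hn

variable [Fintype U]

theorem isConstituent_iff (φ : IrrChar ℂ U) (σ : IrrChar ℝ U) :
    IsConstituent φ σ ↔ ∑ u, (σ u : ℂ) * φ u ≠ 0 := by
  have hconj : ∑ u, (σ u : ℂ) * starRingEnd ℂ (φ u) = starRingEnd ℂ (∑ u, (σ u : ℂ) * φ u) := by
    simp [map_sum, map_mul]
  have hcard : (1 / (Fintype.card U : ℂ)) ≠ 0 :=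
    one_div_ne_zero (by exact_mod_cast Fintype.card_ne_zero)
  rw [IsConstituent, hconj, mul_ne_zero_iff_left hcard, map_ne_zero]

theorem exists_isConstituent (σ : IrrChar ℝ U) : ∃ φ : IrrChar ℂ U, IsConstituent φ σ := by
  obtain ⟨φ, hφ⟩ := exists_sum_mul_ne_zero ℂ σ.isSymmClassFun (fun h =>
    σ.one_pos.ne' (congrFun h 1))
  exact ⟨φ, (isConstituent_iff φ σ).2 hφ⟩

theorem exists_isConstituent_of (φ : IrrChar ℂ U) : ∃ σ : IrrChar ℝ U, IsConstituent φ σ := by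
  obtain ⟨σ, hσ⟩ := exists_sum_mul_ne_zero ℝ φ.isSymmClassFun_re (fun h =>
    φ.re_one_pos.ne' (congrFun h 1))
  refine ⟨σ, (isConstituent_iff φ σ).2 fun h => hσ ?_⟩
  have := congrArg Complex.re h
  simpa [mul_comm] using this

/-- The convolution of `σ` and `Re φ` is computed twice: it is a multiple of `Re φ`, by a factor
that is non-zero because `φ` is a constituent, and by commutativity a multiple of `σ`. Hence the two
are proportional. -/
theorem re_mul_one_of_isConstituent {φ : IrrChar ℂ U} {σ : IrrChar ℝ U} (h : IsConstituent φ σ)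
    (u : U) : (φ u).re * σ 1 = (φ 1).re * σ u := by
  rw [isConstituent_iff] at h
  obtain ⟨μ, h1, h2⟩ := φ.exists_sum_mul σ.isSymmClassFun
  have hμ : μ ≠ 0 := fun h0 => h (h1.trans (by simp [h0]))
  have h3 : conv σ (fun u => (φ u).re) = μ • fun u => (φ u).re := by
    ext u
    have := congrArg Complex.re (h2 u)
    simpa [conv] using this
  rw [φ.isSymmClassFun_re.conv_comm, conv_eq_smul φ.isSymmClassFun_re] at h3
  set c := (∑ u, (φ u).re * σ u) / σ 1
  have h4 : ∀ u, c * σ u = μ * (φ u).re := fun u => congrFun h3 u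
  refine mul_left_cancel₀ hμ ?_
  linear_combination (-σ 1) * h4 u + σ u * h4 1

theorem idem_div_of_isConstituent {φ : IrrChar ℂ U} {σ : IrrChar ℝ U} (h : IsConstituent φ σ)
    (u : U) : ((σ.idem u / σ.idem 1 : ℝ) : ℂ) = ((φ u).re : ℂ) / φ 1 := by
  rw [← φ.ofReal_re_one, ← Complex.ofReal_div, Complex.ofReal_inj, idem_div_idem_one,
    div_eq_div_iff σ.one_pos.ne' φ.re_one_pos.ne', re_mul_one_of_isConstituent h, mul_comm]

/-- By proportionality `σ.idem 1 = σ 1 ^ 2 / normSq` is unchanged when `σ` is replaced by `Re φ`.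
Thus the dimension depends only on `∑ (Re φ) ^ 2`. -/
theorem card_mul_idem_one_mul {φ : IrrChar ℂ U} {σ : IrrChar ℝ U} (h : IsConstituent φ σ) :
    (Fintype.card U * σ.idem 1) * ∑ u, (φ u).re * (φ u).re =
      Fintype.card U * (φ 1).re ^ 2 := by
  have h1 : (∑ u, (φ u).re * (φ u).re) * σ 1 ^ 2 = (φ 1).re ^ 2 * σ.normSq := by
    rw [normSq, Finset.sum_mul, Finset.mul_sum]
    refine Finset.sum_congr rfl fun u _ => ?_
    have := re_mul_one_of_isConstituent h u
    linear_combination ((φ u).re * σ 1 + (φ 1).re * σ u) * this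
  have h2 : σ.idem 1 * σ.normSq = σ 1 ^ 2 := by
    have := σ.normSq_pos.ne'
    simp only [idem, Pi.smul_apply, smul_eq_mul]
    field_simp
  have := σ.normSq_pos.ne'
  refine mul_right_cancel₀ this ?_
  linear_combination (Fintype.card U : ℝ) * h1 +
    (Fintype.card U : ℝ) * (∑ u, (φ u).re * (φ u).re) * h2

theorem card_mul_idem_one_of_real {φ : IrrChar ℂ U} {σ : IrrChar ℝ U} (h : IsConstituent φ σ)
    (hφ : ∀ u, starRingEnd ℂ (φ u) = φ u) :
    ((Fintype.card U * σ.idem 1 : ℝ) : ℂ) = φ 1 ^ 2 := by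
  have h1 := congrArg Complex.re φ.sum_mul_conj
  have him : ∀ u, (φ u).im = 0 := fun u => Complex.conj_eq_iff_im.1 (hφ u)
  have h2 : ∑ u, (φ u).re * (φ u).re = Fintype.card U := by simpa [him] using h1
  have h3 := card_mul_idem_one_mul h
  have hc : (Fintype.card U : ℝ) ≠ 0 := by exact_mod_cast Fintype.card_ne_zero
  rw [h2, mul_comm] at h3
  rw [mul_left_cancel₀ hc h3, ← φ.ofReal_re_one]
  simp

/-- Orthogonality of `φ` and its conjugate gives `∑ φ ^ 2 = 0`, so the squares of real and imaginary
parts have equal sums. Each sum is half of `|U|`, whence the factor 2. -/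
theorem card_mul_idem_one_of_not_real {φ : IrrChar ℂ U} {σ : IrrChar ℝ U} (h : IsConstituent φ σ)
    (hφ : ¬ ∀ u, starRingEnd ℂ (φ u) = φ u) :
    ((Fintype.card U * σ.idem 1 : ℝ) : ℂ) = 2 * φ 1 ^ 2 := by
  have h1 := congrArg Complex.re φ.sum_mul_conj
  obtain ⟨ψ, hψ⟩ := φ.exists_conj
  have hne : φ ≠ ψ := by
    rintro rfl
    exact hφ fun u => (hψ u).symm
  have h2 := congrArg Complex.re (sum_mul_inv_eq_zero hne)
  simp only [ψ.inv_apply, hψ, Complex.conj_conj] at h2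
  simp only [Complex.re_sum, Complex.mul_re, Complex.conj_re, Complex.conj_im, Complex.natCast_re,
    Complex.zero_re, Finset.sum_sub_distrib, mul_neg, sub_neg_eq_add, Finset.sum_add_distrib]
    at h1 h2
  have h4 : ∑ u, (φ u).re * (φ u).re = Fintype.card U / 2 := by linarith
  have h3 := card_mul_idem_one_mul h
  have hc : (Fintype.card U : ℝ) ≠ 0 := by exact_mod_cast Fintype.card_ne_zero
  rw [h4] at h3
  have h5 : Fintype.card U * σ.idem 1 = 2 * (φ 1).re ^ 2 := by
    refine mul_left_cancel₀ hc ?_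
    linear_combination 2 * h3
  rw [h5, ← φ.ofReal_re_one]
  simp

/-- If all complex characters are real-valued, then they correspond to the real characters. -/
theorem exists_equiv_real (hU : ∀ (φ : IrrChar ℂ U) u, starRingEnd ℂ (φ u) = φ u) :
    ∃ E : IrrChar ℂ U ≃ IrrChar ℝ U, ∀ φ, IsConstituent φ (E φ) := by
  choose F hF using fun φ : IrrChar ℂ U => φ.exists_isConstituent_of
  refine ⟨Equiv.ofBijective F ⟨fun φ ψ h => ?_, fun σ => ?_⟩, hF⟩
  · refine eq_of_proportional fun u => ?_
    have h1 := re_mul_one_of_isConstituent (hF φ) u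
    have h2 := re_mul_one_of_isConstituent (hF ψ) u
    rw [← h] at h2
    have hre : ∀ (φ : IrrChar ℂ U) u, (((φ u).re : ℝ) : ℂ) = φ u := fun φ u =>
      Complex.conj_eq_iff_re.1 (hU φ u)
    rw [← hre φ u, ← hre ψ 1, ← hre ψ u, ← hre φ 1]
    norm_cast
    refine mul_right_cancel₀ (F φ).one_pos.ne' ?_
    linear_combination (ψ 1).re * h1 - (φ 1).re * h2
  · obtain ⟨φ, hφ⟩ := σ.exists_isConstituent
    refine ⟨φ, eq_of_proportional fun u => ?_⟩
    have h1 := re_mul_one_of_isConstituent (hF φ) u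
    have h2 := re_mul_one_of_isConstituent hφ u
    refine mul_left_cancel₀ φ.re_one_pos.ne' ?_
    linear_combination (F φ 1) * h2 - σ 1 * h1

end IrrChar

/-! ### Group models of a permutation action -/

theorem IsSymmClassFun.eq_of_mem_symClass {U : Type*} [Group U] {f : U → ℝ}
    (hf : IsSymmClassFun f) {u v : U} (h : v ∈ symClass u) : f v = f u := by
  rcases h with h | h <;> obtain ⟨g, rfl⟩ := isConj_iff.1 h
  · rw [hf.conj]
  · rw [hf.conj, hf.inv]

/-- The action of `G` on `Ω` is modelled by a bijection `e` with a group `U` if the orbits on pairs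
correspond to the unions of the conjugacy classes of `u` and `u⁻¹` for `u` in `U`. -/
def IsGroupModel (G : Type*) {Ω U : Type*} [Group G] [MulAction G Ω] [Group U] (e : U ≃ Ω) : Prop :=
  ∀ u v u' v', (∃ g : G, g • e u = e u' ∧ g • e v = e v') ↔ u'⁻¹ * v' ∈ symClass (u⁻¹ * v)

theorem IsSymmClassFun.conv_inv {U : Type*} [Group U] [Fintype U] {f h : U → ℝ}
    (hf : IsSymmClassFun f) (hh : IsSymmClassFun h) (u : U) : conv f h u⁻¹ = conv h f u := by
  refine Fintype.sum_equiv (Equiv.mulLeft u) _ _ fun v => ?_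
  change _ = h (u * v) * f ((u * v)⁻¹ * u)
  rw [← hh.inv (u * v), ← hf.inv ((u * v)⁻¹ * u), _root_.mul_comm (f v)]
  simp

theorem mem_symClass_self {U : Type*} [Group U] (u : U) : u ∈ symClass u := Or.inl (IsConj.refl u)

theorem Realization.toFun_mem_linSpan {G Ω : Type*} [Group G] [MulAction G Ω]
    (B : Realization G Ω) (ω : Ω) : B.toFun ω ∈ B.linSpan := Submodule.subset_span ⟨ω, rfl⟩

theorem Realization.ρ_mem_linSpan {G Ω : Type*} [Group G] [MulAction G Ω] (B : Realization G Ω)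
    (g : G) {w : B.V} (hw : w ∈ B.linSpan) : B.ρ g w ∈ B.linSpan := by
  induction hw using Submodule.span_induction with
  | mem w hw =>
    obtain ⟨ω, rfl⟩ := hw
    rw [← B.map_smul]
    exact B.toFun_mem_linSpan _
  | zero => simp
  | add x y _ _ hx hy => rw [_root_.map_add]; exact add_mem hx hy
  | smul c x _ hx => rw [_root_.map_smul]; exact Submodule.smul_mem _ _ hx

theorem Realization.eq_zero_of_mem_linSpan {G Ω U : Type*} [Group G] [MulAction G Ω]
    (B : Realization G Ω) (e : U ≃ Ω) {v : B.V} (hv : v ∈ B.linSpan)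
    (h : ∀ u, ⟪v, B.toFun (e u)⟫_ℝ = 0) : v = 0 := by
  have : ∀ w ∈ B.linSpan, ⟪v, w⟫_ℝ = 0 := by
    intro w hw
    induction hw using Submodule.span_induction with
    | mem w hw =>
      obtain ⟨ω, rfl⟩ := hw
      simpa using h (e.symm ω)
    | zero => simp
    | add x y _ _ hx hy => rw [inner_add_right, hx, hy, add_zero]
    | smul c x _ hx => rw [inner_smul_right, hx, mul_zero]
  exact inner_self_eq_zero.1 (this v hv)

namespace IsGroupModel

variable {G Ω U : Type*} [Group G] [MulAction G Ω] [Group U] {e : U ≃ Ω}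

theorem exists_smul (H : IsGroupModel G e) (u u' : U) : ∃ g : G, g • e u = e u' := by
  obtain ⟨g, hg, -⟩ := (H u u u' u').2 (by simp [mem_symClass_self])
  exact ⟨g, hg⟩

/-- Invariant functions of pairs are given by symmetric class functions. -/
theorem exists_isSymmClassFun (H : IsGroupModel G e) {K : Ω → Ω → ℝ}
    (hK : ∀ (g : G) ξ η, K (g • ξ) (g • η) = K ξ η) :
    ∃ f : U → ℝ, IsSymmClassFun f ∧ ∀ u v, K (e u) (e v) = f (u⁻¹ * v) := by
  have key : ∀ u v w, w ∈ symClass (u⁻¹ * v) → K (e u) (e v) = K (e 1) (e w) := by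
    intro u v w hw
    obtain ⟨g, h1, h2⟩ := (H u v 1 w).2 (by simpa using hw)
    rw [← h1, ← h2, hK]
  refine ⟨fun w => K (e 1) (e w), ⟨fun g u => ?_, fun u => ?_⟩, fun u v => ?_⟩
  · exact (key 1 u _ (Or.inl (isConj_iff.2 ⟨g, by simp⟩))).symm
  · exact (key 1 u _ (Or.inr (by simpa using IsConj.refl u⁻¹))).symm
  · exact key u v _ (mem_symClass_self _)

theorem symm_smul (H : IsGroupModel G e) {f : U → ℝ} (hf : IsSymmClassFun f) (g : G) (ξ η : Ω) :
    f ((e.symm (g • ξ))⁻¹ * e.symm (g • η)) = f ((e.symm ξ)⁻¹ * e.symm η) :=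
  hf.eq_of_mem_symClass ((H _ _ _ _).1 ⟨g, by simp, by simp⟩)

/-- Swapping the members of a pair inverts `u⁻¹ * v`. The set `symClass u` is closed under
inversion, so unordered pairs give the same orbits as ordered ones. -/
theorem layer_eq (H : IsGroupModel G e) (u : U) : layer G (e 1) (e u) = e '' symClass u := by
  ext η
  obtain ⟨v, rfl⟩ := e.surjective η
  rw [e.injective.mem_set_image]
  have h1 := H 1 u 1 v
  have h2 := H 1 u v 1
  simp only [inv_one, one_mul, mul_one] at h1 h2
  have h3 : v⁻¹ ∈ symClass u → v ∈ symClass u := by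
    rintro (h | h) <;> obtain ⟨g, hg⟩ := isConj_iff.1 h
    · exact Or.inr (isConj_iff.2 ⟨g, by rw [← inv_inv v, ← hg]; group⟩)
    · exact Or.inl (isConj_iff.2 ⟨g, by rw [← inv_inv v, ← hg]; group⟩)
  simp only [layer, Set.mem_ofPred_eq, Sym2.map_mk, Sym2.eq_iff]
  constructor
  · rintro ⟨g, h | h⟩
    · exact h1.1 ⟨g, h⟩
    · exact h3 (h2.1 ⟨g, h⟩)
  · intro h
    obtain ⟨g, hg⟩ := h1.2 h
    exact ⟨g, Or.inl hg⟩

variable [Fintype U]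

/-! ### Gram kernels, purity, Wythoff space and dimension -/

section Realization

variable (B : Realization G Ω)

omit [Fintype U] in
theorem exists_kernel (H : IsGroupModel G e) : ∃ f : U → ℝ, IsSymmClassFun f ∧
    ∀ u v, ⟪B.toFun (e u), B.toFun (e v)⟫_ℝ = f (u⁻¹ * v) :=
  H.exists_isSymmClassFun (K := fun ξ η => ⟪B.toFun ξ, B.toFun η⟫_ℝ) fun g ξ η => by
    rw [B.map_smul, B.map_smul, LinearIsometryEquiv.inner_map_map]

/-- The combination of the points of a realization with coefficients given by a function. -/
def combination (e : U ≃ Ω) (h : U → ℝ) (u : U) : B.V := ∑ v, h (v⁻¹ * u) • B.toFun (e v)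

theorem combination_mem (h : U → ℝ) (u : U) : combination B e h u ∈ B.linSpan :=
  Submodule.sum_mem _ fun _ _ => Submodule.smul_mem _ _ (B.toFun_mem_linSpan _)

theorem inner_combination_right {k : U → ℝ} {x : B.V} {u : U}
    (hx : ∀ v, ⟪x, B.toFun (e v)⟫_ℝ = k (u⁻¹ * v)) (h : U → ℝ) (w : U) :
    ⟪x, combination B e h w⟫_ℝ = conv k h (u⁻¹ * w) := by
  simp only [combination, inner_sum, inner_smul_right, hx, conv]
  refine Fintype.sum_equiv (Equiv.mulLeft u⁻¹) _ _ fun v => ?_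
  simp [mul_comm, mul_assoc]

theorem inner_combination_left {f : U → ℝ} (hf : IsSymmClassFun f)
    (hB : ∀ u v, ⟪B.toFun (e u), B.toFun (e v)⟫_ℝ = f (u⁻¹ * v)) {h : U → ℝ}
    (hh : IsSymmClassFun h) (u w : U) :
    ⟪combination B e h u, B.toFun (e w)⟫_ℝ = conv h f (u⁻¹ * w) := by
  rw [real_inner_comm, inner_combination_right B (hB w), ← hf.conv_inv hh, mul_inv_rev, inv_inv]

/-- Replacing points by combinations convolves the Gram kernel on either side. With `h = h' =
σ.idem` this isolates the component at `σ`. -/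
theorem inner_combination {f : U → ℝ} (hf : IsSymmClassFun f)
    (hB : ∀ u v, ⟪B.toFun (e u), B.toFun (e v)⟫_ℝ = f (u⁻¹ * v)) {h : U → ℝ}
    (hh : IsSymmClassFun h) (h' : U → ℝ) (u w : U) :
    ⟪combination B e h u, combination B e h' w⟫_ℝ = conv (conv h f) h' (u⁻¹ * w) :=
  inner_combination_right B (inner_combination_left B hf hB hh u) h' w

theorem ρ_combination (H : IsGroupModel G e) {h : U → ℝ} (hh : IsSymmClassFun h) (g : G) (u : U) :
    B.ρ g (combination B e h u) = combination B e h (e.symm (g • e u)) := by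
  simp only [combination, map_sum, map_smul, ← B.map_smul]
  refine Fintype.sum_equiv (e.trans ((MulAction.toPerm g).trans e.symm)) _ _ fun v => ?_
  have := H.symm_smul hh g (e v) (e u)
  simp only [e.symm_apply_apply] at this
  simp [this]

/-- The kernel of a realization has non-negative coefficients. -/
theorem coeff_nonneg {f : U → ℝ} (hf : IsSymmClassFun f)
    (hB : ∀ u v, ⟪B.toFun (e u), B.toFun (e v)⟫_ℝ = f (u⁻¹ * v)) {σ : IrrChar ℝ U} {c : ℝ}
    (hc : conv σ.idem f = c • σ.idem) : 0 ≤ c := by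
  -- The squared norm of the `σ`-component of the initial point is `c * σ.idem 1`.
  have h := inner_combination B hf hB σ.idem_isSymmClassFun σ.idem 1 1
  rw [hc, conv_smul_left, σ.conv_idem_self, inv_one, one_mul] at h
  have h1 : 0 ≤ c * σ.idem 1 := by
    rw [← smul_eq_mul, ← Pi.smul_apply, ← h]
    exact real_inner_self_nonneg
  exact nonneg_of_mul_nonneg_left h1 σ.idem_one_pos

/-- The kernel of a pure realization belongs to a single real irreducible character. -/
theorem exists_kernel_of_isPure (H : IsGroupModel G e) (hp : B.IsPure) :
    ∃ (σ : IrrChar ℝ U) (c : ℝ), 0 < c ∧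
      ∀ u v, ⟪B.toFun (e u), B.toFun (e v)⟫_ℝ = c * σ.idem (u⁻¹ * v) := by
  classical
  obtain ⟨f, hf, hB⟩ := H.exists_kernel B
  choose c hc using fun σ : IrrChar ℝ U => σ.exists_conv_idem hf
  have hsum := IrrChar.eq_sum_smul_idem hf hc
  -- The span of the `σ`-components of the points is invariant, so by purity it is everything as
  -- soon as `c σ ≠ 0`.
  let W : IrrChar ℝ U → Submodule ℝ B.V := fun σ =>
    Submodule.span ℝ (Set.range (combination B e σ.idem))
  have hW : ∀ σ, c σ ≠ 0 → W σ = B.linSpan := by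
    intro σ hσ
    have hle : W σ ≤ B.linSpan := by
      rw [Submodule.span_le]
      rintro _ ⟨u, rfl⟩
      exact combination_mem B _ u
    refine (hp.2 (W σ) hle fun g w hw => ?_).resolve_left fun h => ?_
    · induction hw using Submodule.span_induction with
      | mem w hw =>
        obtain ⟨u, rfl⟩ := hw
        rw [ρ_combination B H σ.idem_isSymmClassFun]
        exact Submodule.subset_span ⟨_, rfl⟩
      | zero => simp
      | add x y _ _ hx hy => rw [map_add]; exact add_mem hx hy
      | smul r x _ hx => rw [map_smul]; exact Submodule.smul_mem _ _ hx
    · have h0 : combination B e σ.idem 1 ∈ W σ := Submodule.subset_span ⟨_, rfl⟩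
      rw [h, Submodule.mem_bot] at h0
      have h1 := inner_combination_left B hf hB σ.idem_isSymmClassFun 1 1
      rw [h0, inner_zero_left, hc, inv_one, one_mul] at h1
      exact mul_ne_zero hσ σ.idem_one_pos.ne' h1.symm
  have hex : ∃ σ, c σ ≠ 0 := by
    by_contra! h
    refine hp.1 ?_
    rw [Realization.linSpan, Submodule.span_eq_bot]
    rintro _ ⟨ω, rfl⟩
    have := hB (e.symm ω) (e.symm ω)
    rw [hsum] at this
    simpa [h] using this
  obtain ⟨σ, hσ⟩ := hex
  have huniq : ∀ τ, τ ≠ σ → c τ = 0 := by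
    intro τ hτ
    by_contra hcτ
    -- Two characters with non-zero coefficients would make the whole span orthogonal to itself.
    have horth : W σ ⟂ W τ := by
      rw [Submodule.isOrtho_span]
      rintro _ ⟨u, rfl⟩ _ ⟨v, rfl⟩
      rw [inner_combination B hf hB σ.idem_isSymmClassFun, hc, conv_smul_left,
        IrrChar.conv_idem_of_ne hτ.symm, smul_zero, Pi.zero_apply]
    rw [hW σ hσ, hW τ hcτ, Submodule.isOrtho_self] at horth
    exact hp.1 horth
  refine ⟨σ, c σ, lt_of_le_of_ne (coeff_nonneg B hf hB (hc σ)) hσ.symm, fun u v => ?_⟩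
  rw [hB, hsum, Finset.sum_eq_single σ]
  · rfl
  · intro τ _ hτ
    rw [huniq τ hτ, zero_smul]
  · simp

variable {B}

/-- Reproducing property: both sides lie in the span and have the same inner products with all
points, because `σ.idem` is idempotent. -/
theorem combination_idem {σ : IrrChar ℝ U} {c : ℝ}
    (hB : ∀ u v, ⟪B.toFun (e u), B.toFun (e v)⟫_ℝ = c * σ.idem (u⁻¹ * v)) (u : U) :
    combination B e σ.idem u = B.toFun (e u) := by
  rw [← sub_eq_zero]
  refine B.eq_zero_of_mem_linSpan e
    (sub_mem (combination_mem B _ _) (B.toFun_mem_linSpan _)) fun v => ?_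
  rw [inner_sub_left, inner_combination_left B (f := c • σ.idem) (σ.idem_isSymmClassFun.smul c) hB
    σ.idem_isSymmClassFun, conv_smul_right, σ.conv_idem_self, hB]
  simp

/-- Equivariant maps into the span of a realization that belongs to a single character are
multiples of the realization. -/
theorem exists_eq_smul (H : IsGroupModel G e) {σ : IrrChar ℝ U} {c : ℝ} (hc : 0 < c)
    (hB : ∀ u v, ⟪B.toFun (e u), B.toFun (e v)⟫_ℝ = c * σ.idem (u⁻¹ * v)) {C : Ω → B.V}
    (hC : ∀ (g : G) ω, C (g • ω) = B.ρ g (C ω)) (hCB : ∀ ω, C ω ∈ B.linSpan) :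
    ∃ r : ℝ, ∀ ω, C ω = r • B.toFun ω := by
  obtain ⟨k, hk, hkC⟩ := H.exists_isSymmClassFun (K := fun ξ η => ⟪C ξ, B.toFun η⟫_ℝ)
    fun g ξ η => by rw [hC, B.map_smul, LinearIsometryEquiv.inner_map_map]
  obtain ⟨d, hd⟩ := σ.exists_conv_idem hk
  -- The mixed kernel of `C` and `B` equals its own convolution with `σ.idem`, hence is `d *
  -- σ.idem`. The Gram kernel of `B` is `c * σ.idem`, which gives the ratio.
  refine ⟨d / c, fun ω => ?_⟩
  obtain ⟨u, rfl⟩ := e.surjective ω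
  rw [← sub_eq_zero]
  refine B.eq_zero_of_mem_linSpan e
    (sub_mem (hCB _) (Submodule.smul_mem _ _ (B.toFun_mem_linSpan _))) fun v => ?_
  have h1 := inner_combination_right B (hkC u) σ.idem v
  rw [combination_idem hB, σ.idem_isSymmClassFun.conv_comm, hd] at h1
  rw [inner_sub_left, h1, inner_smul_left, hB]
  simp only [Pi.smul_apply, smul_eq_mul, conj_trivial]
  field_simp
  ring

theorem ne_zero_of_kernel {σ : IrrChar ℝ U} {c : ℝ} (hc : 0 < c)
    (hB : ∀ u v, ⟪B.toFun (e u), B.toFun (e v)⟫_ℝ = c * σ.idem (u⁻¹ * v)) (ω : Ω) :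
    B.toFun ω ≠ 0 := by
  intro h0
  have h := hB (e.symm ω) (e.symm ω)
  rw [e.apply_symm_apply, h0, inner_zero_left, inv_mul_cancel] at h
  exact (mul_pos hc σ.idem_one_pos).ne h

/-- Orthogonal projection to an invariant subspace `W` commutes with `G`, so on the points it is
multiplication by some `r`. Either `r = 0` and `W` is zero, or `W` contains all points. -/
theorem isPure_of_kernel (H : IsGroupModel G e) {σ : IrrChar ℝ U} {c : ℝ} (hc : 0 < c)
    (hB : ∀ u v, ⟪B.toFun (e u), B.toFun (e v)⟫_ℝ = c * σ.idem (u⁻¹ * v)) : B.IsPure := by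
  have hne := ne_zero_of_kernel hc hB
  refine ⟨fun h => hne (e 1) ?_, fun W hW hinv => ?_⟩
  · have := B.toFun_mem_linSpan (e 1)
    rwa [h, Submodule.mem_bot] at this
  have hcomm : ∀ (g : G) v, W.starProjection (B.ρ g v) = B.ρ g (W.starProjection v) := by
    intro g v
    refine Submodule.eq_starProjection_of_mem_of_inner_eq_zero
      (hinv g _ (W.starProjection_apply_mem v)) fun w hw => ?_
    rw [← map_sub, ← (B.ρ g).apply_symm_apply w, LinearIsometryEquiv.inner_map_map]
    refine W.starProjection_inner_eq_zero v _ ?_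
    have := hinv g⁻¹ w hw
    rwa [map_inv] at this
  obtain ⟨r, hr⟩ := H.exists_eq_smul hc hB (C := fun ω => W.starProjection (B.toFun ω))
    (fun g ω => by rw [B.map_smul, hcomm]) fun ω => hW (W.starProjection_apply_mem _)
  by_cases h0 : r = 0
  · left
    have hz : ∀ v ∈ B.linSpan, W.starProjection v = 0 := by
      intro v hv
      induction hv using Submodule.span_induction with
      | mem w hw =>
        obtain ⟨ω, rfl⟩ := hw
        rw [hr, h0, zero_smul]
      | zero => simp
      | add x y _ _ hx hy => rw [map_add, hx, hy, add_zero]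
      | smul c x _ hx => rw [map_smul, hx, smul_zero]
    rw [Submodule.eq_bot_iff]
    intro w hw
    rw [← Submodule.starProjection_eq_self_iff.2 hw, hz w (hW hw)]
  · right
    refine le_antisymm hW (Submodule.span_le.2 ?_)
    rintro _ ⟨ω, rfl⟩
    have : r • B.toFun ω ∈ W := by rw [← hr]; exact W.starProjection_apply_mem _
    exact (Submodule.smul_mem_iff _ h0).1 this

theorem finrank_wythoffSpace (H : IsGroupModel G e) (hp : B.IsPure) :
    Module.finrank ℝ (B.wythoffSpace (e 1)) = 1 := by
  obtain ⟨σ, c, hc, hB⟩ := H.exists_kernel_of_isPure B hp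
  have hne := ne_zero_of_kernel hc hB (e 1)
  have hmem : B.toFun (e 1) ∈ B.wythoffSpace (e 1) :=
    ⟨B.toFun_mem_linSpan _, fun g hg => by rw [← B.map_smul, MulAction.mem_stabilizer_iff.1 hg]⟩
  refine finrank_eq_one (⟨B.toFun (e 1), hmem⟩ : B.wythoffSpace (e 1))
    (fun h => hne (congrArg Subtype.val h)) ?_
  rintro ⟨w, hw⟩
  -- A vector `w` of the Wythoff space extends to the map `t • e 1 ↦ ρ t w`, which is equivariant
  -- because the stabilizer fixes `w`. Such maps are multiples of `B`.
  choose t ht using fun ω => H.exists_smul 1 (e.symm ω)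
  have ht' : ∀ ω, t ω • e 1 = ω := fun ω => by rw [ht, e.apply_symm_apply]
  obtain ⟨r, hr⟩ := H.exists_eq_smul hc hB (C := fun ω => B.ρ (t ω) w) (fun g ω => by
    have : (t (g • ω))⁻¹ * (g * t ω) ∈ MulAction.stabilizer G (e 1) := by
      rw [MulAction.mem_stabilizer_iff, mul_smul, mul_smul, ht', inv_smul_eq_iff, ht']
    have h := hw.2 _ this
    rw [map_mul, map_inv, map_mul] at h
    exact ((LinearIsometryEquiv.symm_apply_eq _).1 h).symm) fun ω => B.ρ_mem_linSpan _ hw.1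
  refine ⟨r, Subtype.ext ?_⟩
  change r • B.toFun (e 1) = w
  rw [← hr]
  exact hw.2 _ (MulAction.mem_stabilizer_iff.2 (ht' _))

/-- By the reproducing property, `c⁻¹` times the sum of the rank-one operators of the points is a
projection to the span; its trace is the dimension. -/
theorem dim_of_kernel {σ : IrrChar ℝ U} {c : ℝ} (hc : 0 < c)
    (hB : ∀ u v, ⟪B.toFun (e u), B.toFun (e v)⟫_ℝ = c * σ.idem (u⁻¹ * v)) :
    (B.dim : ℝ) = Fintype.card U * σ.idem 1 := by
  let T : B.V →ₗ[ℝ] B.V :=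
    ∑ u, (c⁻¹ • (innerₛₗ ℝ (B.toFun (e u)))).smulRight (B.toFun (e u))
  have hT : ∀ x, T x = ∑ u, (c⁻¹ * ⟪B.toFun (e u), x⟫_ℝ) • B.toFun (e u) := fun x => by
    simp [T, LinearMap.sum_apply]
  have hproj : LinearMap.IsProj B.linSpan T := by
    refine ⟨fun x => ?_, fun x hx => ?_⟩
    · rw [hT]
      exact Submodule.sum_mem _ fun u _ => Submodule.smul_mem _ _ (B.toFun_mem_linSpan _)
    · induction hx using Submodule.span_induction with
      | mem w hw =>
        obtain ⟨ω, rfl⟩ := hw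
        obtain ⟨u, rfl⟩ := e.surjective ω
        rw [hT]
        refine Eq.trans ?_ (combination_idem hB u)
        refine Finset.sum_congr rfl fun v _ => ?_
        rw [hB, inv_mul_cancel_left₀ hc.ne']
      | zero => simp
      | add x y _ _ hx hy => rw [map_add, hx, hy]
      | smul c x _ hx => rw [map_smul, hx]
  have htr := hproj.trace
  rw [Realization.dim, ← htr]
  simp only [T, map_sum, LinearMap.trace_smulRight, LinearMap.smul_apply, innerₛₗ_apply_apply, hB,
    inv_mul_cancel, smul_eq_mul, inv_mul_cancel_left₀ hc.ne']
  simp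

end Realization

end IsGroupModel

/-! ### Classification of pure realizations and the realization cone -/

namespace IsGroupModel

variable {G Ω U : Type*} [Group G] [MulAction G Ω] [Group U] {e : U ≃ Ω} [Fintype U]

/-- The action of `G` on the Euclidean space with coordinates indexed by `Ω`. -/
def coordAction (G : Type*) {Ω U : Type*} [Group G] [MulAction G Ω] [Fintype U] (e : U ≃ Ω) :
    G →* (EuclideanSpace ℝ (Fin (Fintype.card U)) ≃ₗᵢ[ℝ]
      EuclideanSpace ℝ (Fin (Fintype.card U))) :=
  -- Coordinates are indexed by `Fin` because `Realization.V` lives in `Type`, while `Ω` may lie in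
  -- any universe.
  let i : Ω ≃ Fin (Fintype.card U) := e.symm.trans (Fintype.equivFin U)
  { toFun := fun g => LinearIsometryEquiv.piLpCongrLeft 2 ℝ ℝ (i.permCongr (MulAction.toPerm g))
    map_one' := by
      ext x j
      change x (i ((1 : G)⁻¹ • i.symm j)) = x j
      simp
    map_mul' := fun a b => by
      ext x j
      change x (i ((a * b)⁻¹ • i.symm j)) = x (i (b⁻¹ • i.symm (i (a⁻¹ • i.symm j))))
      simp [mul_smul] }

omit [Group U] in
theorem coordAction_apply (g : G) (x : EuclideanSpace ℝ (Fin (Fintype.card U)))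
    (j : Fin (Fintype.card U)) : coordAction G e g x j =
      x (Fintype.equivFin U (e.symm (g⁻¹ • e ((Fintype.equivFin U).symm j)))) :=
  rfl

/-- The realization by the rows of the matrix of convolution with a symmetric class function. -/
def realizationOf (H : IsGroupModel G e) {s : U → ℝ} (hs : IsSymmClassFun s) :
    Realization G Ω where
  V := EuclideanSpace ℝ (Fin (Fintype.card U))
  ρ := coordAction G e
  toFun := fun ω => WithLp.toLp 2 fun j => s ((e.symm ω)⁻¹ * (Fintype.equivFin U).symm j)
  map_smul := fun g ω => by
    ext j
    rw [coordAction_apply]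
    have := H.symm_smul hs g ω (g⁻¹ • e ((Fintype.equivFin U).symm j))
    rw [smul_inv_smul, e.symm_apply_apply] at this
    simpa using this

/-- The Gram matrix of the rows of a symmetric matrix is its square. -/
theorem inner_realizationOf (H : IsGroupModel G e) {s : U → ℝ} (hs : IsSymmClassFun s) (u v : U) :
    ⟪(H.realizationOf hs).toFun (e u), (H.realizationOf hs).toFun (e v)⟫_ℝ =
      conv s s (u⁻¹ * v) := by
  change inner ℝ (WithLp.toLp 2 _ : EuclideanSpace ℝ (Fin (Fintype.card U))) (WithLp.toLp 2 _) = _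
  rw [EuclideanSpace.inner_toLp_toLp]
  simp only [dotProduct, conv, e.symm_apply_apply, star_trivial]
  refine Fintype.sum_equiv ((Fintype.equivFin U).symm.trans (Equiv.mulLeft u⁻¹)) _ _ fun j => ?_
  rw [mul_comm, ← hs.inv (v⁻¹ * _)]
  simp [mul_assoc]

/-- The pure realization that belongs to an irreducible real character. -/
def pure (H : IsGroupModel G e) (σ : IrrChar ℝ U) : PureRealization G Ω :=
  ⟨H.realizationOf σ.idem_isSymmClassFun, H.isPure_of_kernel (σ := σ) one_pos fun u v => by
    rw [inner_realizationOf, σ.conv_idem_self, one_mul]⟩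

theorem inner_pure (H : IsGroupModel G e) (σ : IrrChar ℝ U) (u v : U) :
    ⟪(H.pure σ).1.toFun (e u), (H.pure σ).1.toFun (e v)⟫_ℝ = σ.idem (u⁻¹ * v) :=
  (H.inner_realizationOf σ.idem_isSymmClassFun u v).trans (by rw [σ.conv_idem_self])

theorem cosine_pure (H : IsGroupModel G e) (σ : IrrChar ℝ U) (u : U) :
    (H.pure σ).1.cosine (e 1) (e u) = σ.idem u / σ.idem 1 := by
  rw [Realization.cosine, H.inner_pure, H.inner_pure, inv_one, one_mul, one_mul]

theorem dim_pure (H : IsGroupModel G e) (σ : IrrChar ℝ U) :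
    ((H.pure σ).1.dim : ℝ) = Fintype.card U * σ.idem 1 :=
  dim_of_kernel (e := e) one_pos fun u v => by rw [H.inner_pure, one_mul]

theorem bijective_toClass (H : IsGroupModel G e) :
    Function.Bijective fun σ => (H.pure σ).toClass := by
  refine ⟨fun σ τ h => ?_, fun q => ?_⟩
  · have hs : (H.pure σ).1.Similar (H.pure τ).1 := Quotient.exact h
    obtain ⟨c, hc, hst⟩ := (Realization.similar_iff _ _).1 hs
    have hf : τ.idem = (c * c) • σ.idem := by
      ext u
      have := hst (e 1) (e u)
      rw [H.inner_pure, H.inner_pure, inv_one, one_mul] at this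
      rw [← this]
      simp [mul_assoc]
    by_contra hne
    have h0 := IrrChar.conv_idem_of_ne hne
    rw [hf, conv_smul_right, σ.conv_idem_self] at h0
    exact smul_ne_zero (mul_pos hc hc).ne' σ.idem_ne_zero h0
  · obtain ⟨B, rfl⟩ := Quotient.exists_rep q
    obtain ⟨σ, c, hc, hB⟩ := H.exists_kernel_of_isPure B.1 B.2
    refine ⟨σ, Quotient.sound ?_⟩
    -- Scaling points by `√c` multiplies the Gram kernel by `c`.
    refine (Realization.similar_iff _ _).2 ⟨√c, Real.sqrt_pos.2 hc, fun ξ η => ?_⟩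
    obtain ⟨u, rfl⟩ := e.surjective ξ
    obtain ⟨v, rfl⟩ := e.surjective η
    rw [H.inner_pure, hB, ← mul_assoc, Real.mul_self_sqrt hc.le]

theorem linearIndependent_innerMatrix (H : IsGroupModel G e) :
    LinearIndependent ℝ fun σ => (H.pure σ).1.innerMatrix := by
  let L : Matrix Ω Ω ℝ →ₗ[ℝ] U → ℝ :=
    { toFun := fun M u => M (e 1) (e u)
      map_add' := fun _ _ => rfl
      map_smul' := fun _ _ => rfl }
  refine LinearIndependent.of_comp L ?_
  have : (L ∘ fun σ => (H.pure σ).1.innerMatrix) = IrrChar.idem := by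
    funext σ u
    refine (H.inner_pure σ 1 u).trans ?_
    rw [inv_one, one_mul]
  rw [this]
  exact IrrChar.linearIndependent_idem

theorem realizationCone_eq (H : IsGroupModel G e) :
    realizationCone G Ω =
      (PointedCone.hull ℝ (Set.range fun σ => (H.pure σ).1.innerMatrix) :
        Set (Matrix Ω Ω ℝ)) := by
  classical
  ext Q
  rw [SetLike.mem_coe, PointedCone.hull, Submodule.mem_span_range_iff_exists_fun]
  have hsum : ∀ (c : IrrChar ℝ U → {c : ℝ // 0 ≤ c}) (u v : U),
      (∑ σ, c σ • (H.pure σ).1.innerMatrix) (e u) (e v) =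
        ∑ σ, (c σ : ℝ) * σ.idem (u⁻¹ * v) := by
    intro c u v
    rw [Matrix.sum_apply]
    refine Finset.sum_congr rfl fun σ _ => ?_
    rw [← H.inner_pure]
    rfl
  constructor
  · rintro ⟨B, rfl⟩
    obtain ⟨f, hf, hB⟩ := H.exists_kernel B
    choose c hc using fun σ : IrrChar ℝ U => σ.exists_conv_idem hf
    refine ⟨fun σ => ⟨c σ, coeff_nonneg B hf hB (hc σ)⟩, ?_⟩
    ext ξ η
    obtain ⟨u, rfl⟩ := e.surjective ξ
    obtain ⟨v, rfl⟩ := e.surjective η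
    refine (hsum _ u v).trans (Eq.trans ?_ (hB u v).symm)
    conv_rhs => rw [IrrChar.eq_sum_smul_idem hf hc]
    simp
  · rintro ⟨c, rfl⟩
    -- A convolution square root of the prescribed kernel.
    let s : U → ℝ := ∑ σ : IrrChar ℝ U, √(c σ : ℝ) • σ.idem
    have hs : IsSymmClassFun s := IsSymmClassFun.sum _ fun σ => σ.idem_isSymmClassFun.smul _
    refine ⟨H.realizationOf hs, ?_⟩
    ext ξ η
    obtain ⟨u, rfl⟩ := e.surjective ξ
    obtain ⟨v, rfl⟩ := e.surjective η
    refine (H.inner_realizationOf hs u v).trans (Eq.trans ?_ (hsum c u v).symm)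
    have : conv s s = ∑ σ : IrrChar ℝ U, (c σ : ℝ) • σ.idem := by
      rw [show conv s s = conv (∑ σ : IrrChar ℝ U, √(c σ : ℝ) • σ.idem) s from rfl, conv_sum_left]
      refine Finset.sum_congr rfl fun σ _ => ?_
      rw [conv_smul_left, IrrChar.conv_idem_sum, if_pos (Finset.mem_univ _), smul_smul,
        Real.mul_self_sqrt (c σ).2]
    rw [this, Finset.sum_apply]
    rfl

end IsGroupModel

/-! ### The wreath product -/

section Wreath

/-- The element `(x, y) s` of the wreath product. -/
def wr {U : Type*} (x y : U) (s : C2) : U ≀ᵣ C2 := ⟨fun i => if i = 1 then x else y, s⟩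

theorem C2.eq_one_or_eq_t : ∀ s : C2, s = 1 ∨ s = C2.t := by decide

theorem C2.t_ne_one : C2.t ≠ 1 := by decide

theorem wr_surjective {U : Type*} (g : U ≀ᵣ C2) : ∃ x y s, g = wr x y s := by
  refine ⟨g.left 1, g.left C2.t, g.right, RegularWreathProduct.ext (funext fun i => ?_) rfl⟩
  rcases C2.eq_one_or_eq_t i with rfl | rfl <;> simp [wr]

variable {U : Type*} [Group U]

theorem mem_diagC2 (x y : U) (s : C2) : wr x y s ∈ diagC2 U ↔ x = y := by
  change (wr x y s).left 1 = (wr x y s).left C2.t ↔ _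
  simp [wr]

theorem invMul_wr (x y : U) (s : C2) : invMul (wr x y s) = x⁻¹ * y := by
  simp [invMul, wr]

theorem wr_mul_one (a b x y : U) (s : C2) : wr a b 1 * wr x y s = wr (a * x) (b * y) s := by
  refine RegularWreathProduct.ext (funext fun i => ?_) (by simp [wr])
  rcases C2.eq_one_or_eq_t i with rfl | rfl <;> simp [wr]

theorem wr_mul_t (a b x y : U) (s : C2) :
    wr a b C2.t * wr x y s = wr (a * y) (b * x) (C2.t * s) := by
  refine RegularWreathProduct.ext (funext fun i => ?_) (by simp [wr])
  rcases C2.eq_one_or_eq_t i with rfl | rfl <;> simp [wr]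

/-- Membership in the diagonal compares the two components; the swaps only exchange the sides of the
equation. -/
theorem wr_inv_mul (a b x y : U) (s t : C2) :
    (wr a b s)⁻¹ * wr x y t ∈ diagC2 U ↔ a⁻¹ * x = b⁻¹ * y := by
  have h : ∀ g : U ≀ᵣ C2, wr a b s * g = wr x y t → (g ∈ diagC2 U ↔ a⁻¹ * x = b⁻¹ * y) := by
    intro g hg
    obtain ⟨p, q, r, rfl⟩ := wr_surjective g
    rw [mem_diagC2]
    rcases C2.eq_one_or_eq_t s with rfl | rfl
    · rw [wr_mul_one] at hg
      have h1 := congrFun (congrArg RegularWreathProduct.left hg) 1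
      have h2 := congrFun (congrArg RegularWreathProduct.left hg) C2.t
      simp only [wr, if_true, C2.t_ne_one, if_false] at h1 h2
      rw [← h1, ← h2]
      simp
    · rw [wr_mul_t] at hg
      have h1 := congrFun (congrArg RegularWreathProduct.left hg) 1
      have h2 := congrFun (congrArg RegularWreathProduct.left hg) C2.t
      simp only [wr, if_true, C2.t_ne_one, if_false] at h1 h2
      rw [← h1, ← h2]
      simp [eq_comm]
  exact h _ (mul_inv_cancel_left _ _)

/-- The bijection between `U` and the cosets of `C₂ × diag(U)` in the wreath product. -/
def wreathEquiv (U : Type*) [Group U] : U ≃ (U ≀ᵣ C2) ⧸ diagC2 U :=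
  Equiv.ofBijective (fun u => ((wr 1 u 1 : U ≀ᵣ C2) : (U ≀ᵣ C2) ⧸ diagC2 U)) (by
    constructor
    · intro u v h
      have := QuotientGroup.eq.1 h
      rw [wr_inv_mul] at this
      simpa [eq_inv_mul_iff_mul_eq] using this
    · intro q
      obtain ⟨g, rfl⟩ := QuotientGroup.mk_surjective q
      obtain ⟨x, y, s, rfl⟩ := wr_surjective g
      refine ⟨y * x⁻¹, QuotientGroup.eq.2 ?_⟩
      rw [wr_inv_mul]
      simp)

theorem mk_wr (x y : U) (s : C2) :
    ((wr x y s : U ≀ᵣ C2) : (U ≀ᵣ C2) ⧸ diagC2 U) = wreathEquiv U (y * x⁻¹) := by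
  refine (QuotientGroup.eq.2 ?_).symm
  rw [wr_inv_mul]
  simp

theorem wr_smul_one (a b u : U) :
    wr a b 1 • wreathEquiv U u = wreathEquiv U (b * u * a⁻¹) := by
  rw [← mul_one (a : U), ← mk_wr (s := 1), mul_one]
  change ((wr a b 1 * wr 1 u 1 : U ≀ᵣ C2) : (U ≀ᵣ C2) ⧸ diagC2 U) = _
  rw [wr_mul_one, mul_one]

theorem wr_smul_t (a b u : U) :
    wr a b C2.t • wreathEquiv U u = wreathEquiv U (b * u⁻¹ * a⁻¹) := by
  change ((wr a b C2.t * wr 1 u 1 : U ≀ᵣ C2) : (U ≀ᵣ C2) ⧸ diagC2 U) = _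
  rw [wr_mul_t, mk_wr]
  simp [mul_assoc]

/-- `(a, b)` acts as `u ↦ b * u * a⁻¹` and conjugates `u⁻¹ * v` by `a`; with the swap, the inverse
of `u⁻¹ * v` is conjugated by `a * u`. Conversely, a conjugating element fixes `a`, and sending `u`
to `u'` fixes `b`. -/
theorem isGroupModel_wreath (U : Type*) [Group U] : IsGroupModel (U ≀ᵣ C2) (wreathEquiv U) := by
  intro u v u' v'
  constructor
  · rintro ⟨g, hu, hv⟩
    obtain ⟨a, b, s, rfl⟩ := wr_surjective g
    rcases C2.eq_one_or_eq_t s with rfl | rfl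
    · rw [wr_smul_one, (wreathEquiv U).apply_eq_iff_eq] at hu hv
      rw [← hu, ← hv]
      exact Or.inl (isConj_iff.2 ⟨a, by group⟩)
    · rw [wr_smul_t, (wreathEquiv U).apply_eq_iff_eq] at hu hv
      rw [← hu, ← hv]
      exact Or.inr (isConj_iff.2 ⟨a * u, by group⟩)
  · rintro (h | h) <;> obtain ⟨a, ha⟩ := isConj_iff.1 h
    · refine ⟨wr a (u' * a * u⁻¹) 1, ?_, ?_⟩ <;>
        rw [wr_smul_one, (wreathEquiv U).apply_eq_iff_eq]
      · group
      · rw [eq_inv_mul_iff_mul_eq] at ha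
        rw [← ha]
        group
    · refine ⟨wr (a * u⁻¹) (u' * a) C2.t, ?_, ?_⟩ <;>
        rw [wr_smul_t, (wreathEquiv U).apply_eq_iff_eq]
      · group
      · rw [eq_inv_mul_iff_mul_eq] at ha
        rw [← ha]
        group

end Wreath

/-! ### Icosians -/

/-- Pairs `(a, b)` of integers, representing `a + b τ`. -/
abbrev GoldInt : Type := ℤ × ℤ

/-- Multiplication in `ℤ[τ]`. -/
def GoldInt.mul (x y : GoldInt) : GoldInt :=
  (x.1 * y.1 + x.2 * y.2, x.1 * y.2 + x.2 * y.1 + x.2 * y.2)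

/-- Quadruples of elements of `ℤ[τ]`, representing the doubled coordinates of a quaternion. -/
abbrev Icosian : Type := GoldInt × GoldInt × GoldInt × GoldInt

/-- The product of the quaternions with the given coordinates. -/
def Icosian.mul : Icosian → Icosian → Icosian
  | (a, b, c, d), (a', b', c', d') =>
    (a.mul a' - b.mul b' - c.mul c' - d.mul d', a.mul b' + b.mul a' + c.mul d' - d.mul c',
      a.mul c' - b.mul d' + c.mul a' + d.mul b', a.mul d' + b.mul c' - c.mul b' + d.mul a')

/-- The position of `± τ` in a vertex of the 600-cell whose coordinates `0` and `± 1` are at the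
positions `i` and `j`. -/
def tauPosition (i j : ℕ) : ℕ :=
  -- Evenness of the permutation decides which of the two remaining positions carries `± τ`.
  -- Diagonal entries are fillers.
  ([[0, 2, 3, 1], [3, 0, 0, 2], [1, 3, 0, 0], [2, 0, 1, 0]].getD i []).getD j 0

/-- Lifts an element of the field with five elements to `ℤ[τ]`; `n` is the number of zeros and `b`
tells whether the lift should be `± τ`. -/
def liftCoord (n : ℕ) (b : Bool) (x : Fin 5) : GoldInt :=
  if x = 0 then (0, 0) else if x = 1 then (1, 0) else if x = 4 then (-1, 0) else
  -- Since `τ` reduces to 3, the residue 2 comes from `-τ` or `τ⁻¹ = τ - 1`, or from 2 itself if all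
  -- other coordinates vanish.
  if x = 2 then (if n = 3 then (2, 0) else if b then (0, -1) else (-1, 1))
  else (if n = 3 then (-2, 0) else if b then (0, 1) else (1, -1))

/-- Lifts a vector over the field with five elements to the vertex of the 600-cell with this
reduction modulo `√5`. -/
def liftVector (v : List (Fin 5)) : Icosian :=
  let n := v.count 0
  let t := tauPosition (v.idxOf 0) (v.findIdx fun x => x = 1 ∨ x = 4)
  (liftCoord n (t = 0) (v.getD 0 0), liftCoord n (t = 1) (v.getD 1 0),
    liftCoord n (t = 2) (v.getD 2 0), liftCoord n (t = 3) (v.getD 3 0))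

/-- The doubled coordinates of the vertex of the 600-cell that belongs to the matrix with rows
`(a, b)` and `(c, d)`. -/
def matrixLift (a b c d : Fin 5) : Icosian :=
  -- Over the field with five elements the quaternions split: `i`, `j`, `k` become `!![2, 0; 0,
  -- -2]`, `!![0, 1; -1, 0]`, `!![0, 2; 2, 0]`. The list contains the doubled coordinates of the
  -- matrix in this basis.
  liftVector [a + d, 3 * (a - d), b - c, 3 * (b + c)]

/-- The factor 2 comes from doubled coordinates. Checking two generators suffices for
multiplicativity. -/
theorem matrixLift_mul_upper : ∀ a b c d : Fin 5, a * d - b * c = 1 →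
    (matrixLift 1 1 0 1).mul (matrixLift a b c d) =
      (2 : ℤ) • matrixLift (a + c) (b + d) c d := by
  decide +kernel

theorem matrixLift_mul_lower : ∀ a b c d : Fin 5, a * d - b * c = 1 →
    (matrixLift 1 0 1 1).mul (matrixLift a b c d) =
      (2 : ℤ) • matrixLift a b (a + c) (b + d) := by
  decide +kernel

/-- The reduction of `a + b τ` modulo `√5`. -/
def GoldInt.red (x : GoldInt) : Fin 5 := Fin.ofNat 5 ((x.1 + 3 * x.2) % 5).toNat

/-- The lift is a section of the reduction modulo `√5`, under which `τ` becomes `1 / 2 = 3`; this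
yields injectivity. -/
theorem matrixLift_red : ∀ a b c d : Fin 5, a * d - b * c = 1 →
    (matrixLift a b c d).1.red = a + d ∧ (matrixLift a b c d).2.1.red = 3 * (a - d) ∧
      (matrixLift a b c d).2.2.1.red = b - c ∧ (matrixLift a b c d).2.2.2.red = 3 * (b + c) := by
  decide +kernel

/-- The even permutations of four letters as sequences of values. -/
def evenSequences : List (Fin 4 × Fin 4 × Fin 4 × Fin 4) :=
  [(0, 1, 2, 3), (0, 2, 3, 1), (0, 3, 1, 2), (1, 0, 3, 2), (1, 2, 0, 3), (1, 3, 2, 0),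
    (2, 0, 1, 3), (2, 1, 3, 0), (2, 3, 0, 1), (3, 0, 2, 1), (3, 1, 0, 2), (3, 2, 1, 0)]

theorem exists_perm_of_mem_evenSequences : ∀ p ∈ evenSequences, ∃ s ∈ alternatingGroup (Fin 4),
    (s 0, s 1, s 2, s 3) = p := by
  simp only [Equiv.Perm.mem_alternatingGroup]
  decide +kernel

theorem mem_evenSequences : ∀ s ∈ alternatingGroup (Fin 4),
    (s 0, s 1, s 2, s 3) ∈ evenSequences := by
  simp only [Equiv.Perm.mem_alternatingGroup]
  decide +kernel

/-- The coordinates of an icosian. -/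
def Icosian.coord (z : Icosian) (i : Fin 4) : GoldInt :=
  if i = 0 then z.1 else if i = 1 then z.2.1 else if i = 2 then z.2.2.1 else z.2.2.2

/-- The doubled coordinates of the three kinds of vertices of the 600-cell. -/
def vertexShapes : List (GoldInt × GoldInt × GoldInt × GoldInt) :=
  [((2, 0), (0, 0), (0, 0), (0, 0)), ((1, 0), (1, 0), (1, 0), (1, 0)),
    ((0, 1), (1, 0), (-1, 1), (0, 0))]

theorem exists_shape_matrixLift : ∀ a b c d : Fin 5, a * d - b * c = 1 →
    ∃ p ∈ evenSequences, ∃ t ∈ vertexShapes,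
      ((matrixLift a b c d).coord p.1 = t.1 ∨ (matrixLift a b c d).coord p.1 = -t.1) ∧
      ((matrixLift a b c d).coord p.2.1 = t.2.1 ∨ (matrixLift a b c d).coord p.2.1 = -t.2.1) ∧
      ((matrixLift a b c d).coord p.2.2.1 = t.2.2.1 ∨
        (matrixLift a b c d).coord p.2.2.1 = -t.2.2.1) ∧
      ((matrixLift a b c d).coord p.2.2.2 = t.2.2.2 ∨
        (matrixLift a b c d).coord p.2.2.2 = -t.2.2.2) := by
  decide +kernel

/-- The icosian with the coordinates `± t` at the positions `p`. -/
def signedIcosian (p : Fin 4 × Fin 4 × Fin 4 × Fin 4) (t : GoldInt × GoldInt × GoldInt × GoldInt)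
    (ε : Bool × Bool × Bool × Bool) : Icosian :=
  let sgn := fun (b : Bool) (x : GoldInt) => if b then x else -x
  let f := fun i : Fin 4 =>
    if i = p.1 then sgn ε.1 t.1 else if i = p.2.1 then sgn ε.2.1 t.2.1 else
    if i = p.2.2.1 then sgn ε.2.2.1 t.2.2.1 else sgn ε.2.2.2 t.2.2.2
  (f 0, f 1, f 2, f 3)

/-- The matrix entries that belong to an icosian. -/
def Icosian.entries (z : Icosian) : Fin 5 × Fin 5 × Fin 5 × Fin 5 :=
  (3 * z.1.red + z.2.1.red, 3 * z.2.2.1.red + z.2.2.2.red,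
    z.2.2.2.red - 3 * z.2.2.1.red, 3 * z.1.red - z.2.1.red)

/-- Every vertex is the lift of its own reduction, which gives surjectivity. -/
theorem matrixLift_entries_signedIcosian : ∀ p ∈ evenSequences, ∀ t ∈ vertexShapes, ∀ ε,
    let z := signedIcosian p t ε
    let m := z.entries
    m.1 * m.2.2.2 - m.2.1 * m.2.2.1 = 1 ∧ matrixLift m.1 m.2.1 m.2.2.1 m.2.2.2 = z := by
  decide +kernel

/-- Entries of a representative of the conjugacy class of `SL(2,5)` with given doubled real part. -/
def classRep (x : GoldInt) : Fin 5 × Fin 5 × Fin 5 × Fin 5 :=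
  if x = (2, 0) then (1, 0, 0, 1) else if x = (-2, 0) then (4, 0, 0, 4) else
  if x = (-1, 1) ∨ x = (1, -1) then (0, 3, 3, x.red) else (0, 1, 4, x.red)

/-- The rows `(x, y)` and `(z, w)` form a conjugating matrix. If the upper right entry `l` of the
representative is non-zero, its upper left entry is 0, so the first row forces the second, with `l ^
3 = l⁻¹`. The real part in `ℤ[τ]` is finer than the trace: it separates the two classes that share
the trace 2, or -2, and differ by the non-square 3. -/
theorem exists_conj_classRep : ∀ a b c d : Fin 5, a * d - b * c = 1 → ∃ x y : Fin 5,
    let r := classRep (matrixLift a b c d).1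
    let l := r.2.1
    let z := if l = 0 then 0 else l ^ 3 * (x * a + y * c)
    let w := if l = 0 then 1 else l ^ 3 * (x * b + y * d)
    x * w - y * z = 1 ∧ x * a + y * c = r.1 * x + l * z ∧ x * b + y * d = r.1 * y + l * w ∧
      z * a + w * c = r.2.2.1 * x + r.2.2.2 * z ∧ z * b + w * d = r.2.2.1 * y + r.2.2.2 * w := by
  decide +kernel

/-- The real number represented by a pair of integers. -/
def GoldInt.toReal (x : GoldInt) : ℝ := x.1 + x.2 * Real.goldenRatio

namespace GoldInt

theorem toReal_mul (x y : GoldInt) : toReal (x.mul y) = toReal x * toReal y := by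
  simp only [toReal, mul]
  push_cast
  linear_combination (-(x.2 * y.2 : ℝ)) * Real.goldenRatio_sq

theorem toReal_add (x y : GoldInt) : toReal (x + y) = toReal x + toReal y := by
  simp only [toReal, Prod.fst_add, Prod.snd_add]
  push_cast
  ring

theorem toReal_sub (x y : GoldInt) : toReal (x - y) = toReal x - toReal y := by
  simp only [toReal, Prod.fst_sub, Prod.snd_sub]
  push_cast
  ring

theorem toReal_neg (x : GoldInt) : toReal (-x) = -toReal x := by
  simp only [toReal, Prod.fst_neg, Prod.snd_neg]
  push_cast
  ring

theorem toReal_zsmul (n : ℤ) (x : GoldInt) : toReal (n • x) = n * toReal x := by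
  simp only [toReal, Prod.smul_fst, Prod.smul_snd, smul_eq_mul]
  push_cast
  ring

theorem toReal_injective : Function.Injective toReal := by
  intro x y h
  have hirr := Real.goldenRatio_irrational
  simp only [toReal] at h
  have h2 : x.2 = y.2 := by
    by_contra hne
    have hne' : ((x.2 - y.2 : ℤ) : ℝ) ≠ 0 := by exact_mod_cast sub_ne_zero.2 hne
    refine hirr ⟨((y.1 - x.1 : ℤ) : ℚ) / ((x.2 - y.2 : ℤ) : ℚ), ?_⟩
    push_cast at hne' ⊢
    rw [div_eq_iff hne']
    linear_combination -h
  refine Prod.ext ?_ h2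
  rw [h2] at h
  exact_mod_cast add_right_cancel h

end GoldInt

namespace Icosian

/-- The quaternion with the given doubled coordinates. -/
def toQuat (z : Icosian) : ℍ :=
  ⟨GoldInt.toReal z.1 / 2, GoldInt.toReal z.2.1 / 2, GoldInt.toReal z.2.2.1 / 2,
    GoldInt.toReal z.2.2.2 / 2⟩

theorem toQuat_injective : Function.Injective toQuat := by
  intro z w h
  obtain ⟨h0, h1, h2, h3⟩ := Quaternion.ext_iff.1 h
  simp only [toQuat, div_left_inj' (two_ne_zero' ℝ)] at h0 h1 h2 h3
  exact Prod.ext (GoldInt.toReal_injective h0) (Prod.ext (GoldInt.toReal_injective h1)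
    (Prod.ext (GoldInt.toReal_injective h2) (GoldInt.toReal_injective h3)))

theorem toQuat_mul_of_eq {x y z : Icosian} (h : x.mul y = (2 : ℤ) • z) :
    toQuat x * toQuat y = toQuat z := by
  have h0 := congrArg (fun w : Icosian => GoldInt.toReal w.1) h
  have h1 := congrArg (fun w : Icosian => GoldInt.toReal w.2.1) h
  have h2 := congrArg (fun w : Icosian => GoldInt.toReal w.2.2.1) h
  have h3 := congrArg (fun w : Icosian => GoldInt.toReal w.2.2.2) h
  simp only [mul, Prod.smul_fst, Prod.smul_snd, GoldInt.toReal_zsmul, GoldInt.toReal_add,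
    GoldInt.toReal_sub, GoldInt.toReal_mul] at h0 h1 h2 h3
  push_cast at h0 h1 h2 h3
  refine Quaternion.ext _ _ ?_ ?_ ?_ ?_
  · rw [Quaternion.re_mul]
    simp only [toQuat]
    linear_combination h0 / 4
  · rw [Quaternion.imI_mul]
    simp only [toQuat]
    linear_combination h1 / 4
  · rw [Quaternion.imJ_mul]
    simp only [toQuat]
    linear_combination h2 / 4
  · rw [Quaternion.imK_mul]
    simp only [toQuat]
    linear_combination h3 / 4

theorem quatCoord_toQuat (z : Icosian) (i : Fin 4) :
    quatCoord (toQuat z) i = GoldInt.toReal (z.coord i) / 2 := by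
  fin_cases i <;> rfl

/-- The half of the vector of real numbers represented by a quadruple. -/
def realShape (t : GoldInt × GoldInt × GoldInt × GoldInt) : Fin 4 → ℝ :=
  ![GoldInt.toReal t.1 / 2, GoldInt.toReal t.2.1 / 2, GoldInt.toReal t.2.2.1 / 2,
    GoldInt.toReal t.2.2.2 / 2]

theorem realShape_image : realShape '' {t | t ∈ vertexShapes} =
    {![1, 0, 0, 0], ![1 / 2, 1 / 2, 1 / 2, 1 / 2],
      ![Real.goldenRatio / 2, 1 / 2, Real.goldenRatio⁻¹ / 2, 0]} := by
  have hinv : Real.goldenRatio⁻¹ = -1 + Real.goldenRatio := by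
    rw [Real.inv_goldenRatio, ← Real.one_sub_goldenRatio]
    ring
  have : {t | t ∈ vertexShapes} = {((2, 0), (0, 0), (0, 0), (0, 0)),
      ((1, 0), (1, 0), (1, 0), (1, 0)), ((0, 1), (1, 0), (-1, 1), (0, 0))} := by
    ext t
    simp [vertexShapes]
  rw [this, Set.image_insert_eq, Set.image_insert_eq, Set.image_singleton, hinv]
  simp [realShape, GoldInt.toReal]

theorem realShape_nonneg {t : GoldInt × GoldInt × GoldInt × GoldInt} (ht : t ∈ vertexShapes)
    (i : Fin 4) : 0 ≤ realShape t i := by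
  have h : realShape t ∈ realShape '' {t | t ∈ vertexShapes} := ⟨t, ht, rfl⟩
  rw [realShape_image] at h
  have h1 := Real.goldenRatio_pos
  rcases h with h | h | h <;> rw [h] <;> fin_cases i <;> simp <;> positivity

theorem mem_cell600_iff (q : ℍ) : q ∈ cell600 ↔ ∃ p ∈ evenSequences, ∃ t ∈ vertexShapes,
    |quatCoord q p.1| = GoldInt.toReal t.1 / 2 ∧ |quatCoord q p.2.1| = GoldInt.toReal t.2.1 / 2 ∧
      |quatCoord q p.2.2.1| = GoldInt.toReal t.2.2.1 / 2 ∧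
      |quatCoord q p.2.2.2| = GoldInt.toReal t.2.2.2 / 2 := by
  rw [cell600, ← realShape_image]
  constructor
  · rintro ⟨s, hs, _, ⟨t, ht, rfl⟩, h⟩
    exact ⟨_, mem_evenSequences s hs, t, ht, h 0, h 1, h 2, h 3⟩
  · rintro ⟨p, hp, t, ht, h0, h1, h2, h3⟩
    obtain ⟨s, hs, rfl⟩ := exists_perm_of_mem_evenSequences p hp
    refine ⟨s, hs, _, ⟨t, ht, rfl⟩, fun i => ?_⟩
    fin_cases i
    exacts [h0, h1, h2, h3]

theorem abs_quatCoord_toQuat {z : Icosian} {i j : Fin 4}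
    {t : GoldInt × GoldInt × GoldInt × GoldInt} (ht : t ∈ vertexShapes) {x : GoldInt}
    (hx : realShape t j = GoldInt.toReal x / 2) (h : z.coord i = x ∨ z.coord i = -x) :
    |quatCoord (toQuat z) i| = GoldInt.toReal x / 2 := by
  have hn := realShape_nonneg ht j
  rw [hx] at hn
  rw [quatCoord_toQuat]
  rcases h with h | h <;> rw [h]
  · exact abs_of_nonneg hn
  · rw [GoldInt.toReal_neg, neg_div, abs_neg, abs_of_nonneg hn]

theorem toQuat_matrixLift_mem {a b c d : Fin 5} (h : a * d - b * c = 1) :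
    toQuat (matrixLift a b c d) ∈ cell600 := by
  obtain ⟨p, hp, t, ht, h0, h1, h2, h3⟩ := exists_shape_matrixLift a b c d h
  exact (mem_cell600_iff _).2 ⟨p, hp, t, ht, abs_quatCoord_toQuat (j := 0) ht rfl h0,
    abs_quatCoord_toQuat (j := 1) ht rfl h1, abs_quatCoord_toQuat (j := 2) ht rfl h2,
    abs_quatCoord_toQuat (j := 3) ht rfl h3⟩

theorem coord_signedIcosian : ∀ p ∈ evenSequences, ∀ t ∈ vertexShapes, ∀ ε,
    let z := signedIcosian p t ε
    z.coord p.1 = (if ε.1 then t.1 else -t.1) ∧ z.coord p.2.1 = (if ε.2.1 then t.2.1 else -t.2.1) ∧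
      z.coord p.2.2.1 = (if ε.2.2.1 then t.2.2.1 else -t.2.2.1) ∧
      z.coord p.2.2.2 = (if ε.2.2.2 then t.2.2.2 else -t.2.2.2) := by
  decide +kernel

theorem forall_of_evenSequence : ∀ p ∈ evenSequences, ∀ i : Fin 4,
    i = p.1 ∨ i = p.2.1 ∨ i = p.2.2.1 ∨ i = p.2.2.2 := by
  decide +kernel

theorem exists_toQuat_matrixLift {q : ℍ} (hq : q ∈ cell600) : ∃ a b c d : Fin 5,
    a * d - b * c = 1 ∧ toQuat (matrixLift a b c d) = q := by
  obtain ⟨p, hp, t, ht, h0, h1, h2, h3⟩ := (mem_cell600_iff q).1 hq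
  have hsgn : ∀ {y : ℝ} {x : GoldInt}, |y| = GoldInt.toReal x / 2 →
      ∃ ε : Bool, GoldInt.toReal (if ε then x else -x) / 2 = y := by
    intro y x h
    rcases le_total 0 y with hy | hy
    · refine ⟨true, ?_⟩
      rw [abs_of_nonneg hy] at h
      exact h.symm
    · refine ⟨false, ?_⟩
      rw [abs_of_nonpos hy] at h
      rw [if_neg Bool.false_ne_true, GoldInt.toReal_neg, neg_div, ← h, neg_neg]
  obtain ⟨ε0, e0⟩ := hsgn h0
  obtain ⟨ε1, e1⟩ := hsgn h1
  obtain ⟨ε2, e2⟩ := hsgn h2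
  obtain ⟨ε3, e3⟩ := hsgn h3
  obtain ⟨hdet, hlift⟩ := matrixLift_entries_signedIcosian p hp t ht (ε0, ε1, ε2, ε3)
  refine ⟨_, _, _, _, hdet, ?_⟩
  rw [hlift]
  obtain ⟨c0, c1, c2, c3⟩ := coord_signedIcosian p hp t ht (ε0, ε1, ε2, ε3)
  have key : ∀ i, quatCoord (toQuat (signedIcosian p t (ε0, ε1, ε2, ε3))) i = quatCoord q i := by
    intro i
    rw [quatCoord_toQuat]
    rcases forall_of_evenSequence p hp i with rfl | rfl | rfl | rfl
    · rw [c0, e0]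
    · rw [c1, e1]
    · rw [c2, e2]
    · rw [c3, e3]
  exact Quaternion.ext _ _ (key 0) (key 1) (key 2) (key 3)

end Icosian

/-! ### The multiplicative embedding of SL(2,5) into the quaternions -/

namespace SL25

/-- The doubled coordinates of the vertex of the 600-cell that belongs to a matrix. -/
def lift (u : SL25) : Icosian := matrixLift (u 0 0) (u 0 1) (u 1 0) (u 1 1)

theorem det_entries (u : SL25) :
    (u 0 0 : Fin 5) * (u 1 1 : Fin 5) - (u 0 1 : Fin 5) * (u 1 0 : Fin 5) = 1 := by
  have h := u.2
  rw [Matrix.det_fin_two] at h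
  exact h

/-- The matrix with the given entries. -/
def mk (a b c d : ZMod 5) (h : a * d - b * c = 1) : SL25 :=
  ⟨!![a, b; c, d], by rw [Matrix.det_fin_two_of]; exact h⟩

theorem ext {u v : SL25} (h0 : u 0 0 = v 0 0) (h1 : u 0 1 = v 0 1) (h2 : u 1 0 = v 1 0)
    (h3 : u 1 1 = v 1 1) : u = v := by
  refine Subtype.ext (Matrix.ext fun i j => ?_)
  fin_cases i <;> fin_cases j
  exacts [h0, h1, h2, h3]

theorem mul_apply (u v : SL25) (i j : Fin 2) : (u * v) i j = u i 0 * v 0 j + u i 1 * v 1 j := by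
  rw [Matrix.SpecialLinearGroup.coe_mul, Matrix.mul_apply, Fin.sum_univ_two]

theorem lift_injective : Function.Injective lift := by
  intro u v h
  have h1 := matrixLift_red _ _ _ _ (det_entries u)
  have h2 := matrixLift_red _ _ _ _ (det_entries v)
  change (lift u).1.red = _ ∧ (lift u).2.1.red = _ ∧ (lift u).2.2.1.red = _ ∧
    (lift u).2.2.2.red = _ at h1
  rw [h] at h1
  obtain ⟨a0, a1, a2, a3⟩ := h1
  obtain ⟨b0, b1, b2, b3⟩ := h2
  have key : ∀ a b c d a' b' c' d' : ZMod 5, a + d = a' + d' → 3 * (a - d) = 3 * (a' - d') →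
      b - c = b' - c' → 3 * (b + c) = 3 * (b' + c') → a = a' ∧ b = b' ∧ c = c' ∧ d = d' := by
    intro a b c d a' b' c' d' h0 h1 h2 h3
    have h5 : (5 : ZMod 5) = 0 := rfl
    refine ⟨?_, ?_, ?_, ?_⟩
    · linear_combination 3 * h0 + h1 - (a - a') * h5
    · linear_combination 3 * h2 + h3 - (b - b') * h5
    · linear_combination (-3) * h2 + h3 - (c - c') * h5
    · linear_combination 3 * h0 - h1 - (d - d') * h5
  obtain ⟨k0, k1, k2, k3⟩ := key _ _ _ _ _ _ _ _ (a0.symm.trans b0) (a1.symm.trans b1)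
    (a2.symm.trans b2) (a3.symm.trans b3)
  exact ext k0 k1 k2 k3

/-- The vertex of the 600-cell that belongs to a matrix. -/
def quat (u : SL25) : ℍ := (lift u).toQuat

/-- The matrix `!![1, 1; 0, 1]`. -/
def upper : SL25 := mk 1 1 0 1 (by decide)

/-- The matrix `!![1, 0; 1, 1]`. -/
def lower : SL25 := mk 1 0 1 1 (by decide)

/-- These are the entries of a product of four elementary matrices, alternately upper and lower. -/
theorem exists_factorization : ∀ a b c d : Fin 5, a * d - b * c = 1 → ∃ i j k l : Fin 5,
    a = (1 + i * j) * (1 + k * l) + i * l ∧ b = (1 + i * j) * k + i ∧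
      c = j * (1 + k * l) + l ∧ d = j * k + 1 := by
  decide +kernel

theorem exists_factorization' : ∀ a b c d : ZMod 5, a * d - b * c = 1 → ∃ i j k l : ZMod 5,
    a = (1 + i * j) * (1 + k * l) + i * l ∧ b = (1 + i * j) * k + i ∧
      c = j * (1 + k * l) + l ∧ d = j * k + 1 :=
  exists_factorization

theorem upper_pow : ∀ i : ZMod 5, upper ^ i.val = mk 1 i 0 1 (by simp) := by
  decide +kernel

theorem lower_pow : ∀ i : ZMod 5, lower ^ i.val = mk 1 0 i 1 (by simp) := by
  decide +kernel

theorem quat_one : quat 1 = 1 := by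
  have h : lift 1 = ((2, 0), (0, 0), (0, 0), (0, 0)) := by decide +kernel
  rw [quat, h]
  refine Quaternion.ext _ _ ?_ ?_ ?_ ?_ <;> simp [Icosian.toQuat, GoldInt.toReal]

theorem quat_mul (u v : SL25) : quat (u * v) = quat u * quat v := by
  -- The elements whose left multiplication is respected form a submonoid, so it is enough that it
  -- contains both elementary generators.
  let S : Submonoid SL25 :=
    { carrier := {u | ∀ v, quat (u * v) = quat u * quat v}
      one_mem' := fun v => by
        rw [one_mul, quat_one, one_mul]
      mul_mem' := fun {a b} ha hb v => by rw [mul_assoc, ha, hb, ha, mul_assoc] }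
  have hU : upper ∈ S := fun v => by
    refine (Icosian.toQuat_mul_of_eq ?_).symm
    have h := matrixLift_mul_upper _ _ _ _ (det_entries v)
    refine h.trans ?_
    congr 1
    rw [lift]
    simp only [mul_apply]
    congr 1
    · exact (congrArg₂ (· + ·) (one_mul (v 0 0)) (one_mul (v 1 0))).symm
    · exact (congrArg₂ (· + ·) (one_mul (v 0 1)) (one_mul (v 1 1))).symm
    · exact ((congrArg₂ (· + ·) (zero_mul (v 0 0)) (one_mul (v 1 0))).trans (zero_add _)).symm
    · exact ((congrArg₂ (· + ·) (zero_mul (v 0 1)) (one_mul (v 1 1))).trans (zero_add _)).symm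
  have hL : lower ∈ S := fun v => by
    refine (Icosian.toQuat_mul_of_eq ?_).symm
    have h := matrixLift_mul_lower _ _ _ _ (det_entries v)
    refine h.trans ?_
    congr 1
    rw [lift]
    simp only [mul_apply]
    congr 1
    · exact ((congrArg₂ (· + ·) (one_mul (v 0 0)) (zero_mul (v 1 0))).trans (add_zero _)).symm
    · exact ((congrArg₂ (· + ·) (one_mul (v 0 1)) (zero_mul (v 1 1))).trans (add_zero _)).symm
    · exact (congrArg₂ (· + ·) (one_mul (v 0 0)) (one_mul (v 1 0))).symm
    · exact (congrArg₂ (· + ·) (one_mul (v 0 1)) (one_mul (v 1 1))).symm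
  obtain ⟨i, j, k, l, h0, h1, h2, h3⟩ := exists_factorization' _ _ _ _ (det_entries u)
  have hu : u = upper ^ i.val * lower ^ j.val * upper ^ k.val * lower ^ l.val := by
    rw [upper_pow, lower_pow, upper_pow, lower_pow]
    refine ext ?_ ?_ ?_ ?_ <;> simp only [mul_apply]
    · exact h0.trans (by simp [mk]; ring)
    · exact h1.trans (by simp [mk])
    · exact h2.trans (by simp [mk]; ring)
    · exact h3.trans (by simp [mk])
  have : u ∈ S := by
    rw [hu]
    exact S.mul_mem (S.mul_mem (S.mul_mem (S.pow_mem hU _) (S.pow_mem hL _)) (S.pow_mem hU _))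
      (S.pow_mem hL _)
  exact this v

end SL25

/-! ### The 600-cell as a group model -/

namespace SL25

theorem quat_injective : Function.Injective quat :=
  Icosian.toQuat_injective.comp lift_injective

theorem quat_mem (u : SL25) : quat u ∈ cell600 := Icosian.toQuat_matrixLift_mem (det_entries u)

/-- The norm is multiplicative and `u` has finite order. -/
theorem norm_quat (u : SL25) : ‖quat u‖ = 1 := by
  have hpow : ∀ n : ℕ, quat (u ^ n) = quat u ^ n := by
    intro n
    induction n with
    | zero => rw [pow_zero, pow_zero, quat_one]
    | succ n ih => rw [pow_succ, pow_succ, quat_mul, ih]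
  have h := congrArg norm (hpow (orderOf u))
  rw [pow_orderOf_eq_one, quat_one, norm_one, norm_pow] at h
  exact (pow_eq_one_iff_of_nonneg (norm_nonneg _) (orderOf_pos u).ne').1 h.symm

theorem star_quat (u : SL25) : star (quat u) = quat u⁻¹ := by
  have h1 : quat u * star (quat u) = 1 := by
    rw [Quaternion.self_mul_star, Quaternion.normSq_eq_norm_mul_self, norm_quat]
    simp
  have h2 : quat u⁻¹ * quat u = 1 := by rw [← quat_mul, inv_mul_cancel, quat_one]
  exact (left_inv_eq_right_inv h2 h1).symm

/-- The bijection between `SL(2,5)` and the vertices of the 600-cell. -/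
def vertexEquiv : SL25 ≃ cell600 :=
  Equiv.ofBijective (fun u => ⟨quat u, quat_mem u⟩) ⟨fun u v h =>
    quat_injective (congrArg Subtype.val h), fun q => by
    obtain ⟨a, b, c, d, h, hq⟩ := Icosian.exists_toQuat_matrixLift q.2
    exact ⟨mk a b c d h, Subtype.ext hq⟩⟩

/-- Both elements are conjugate to a representative depending only on the real part. -/
theorem isConj_of_lift_eq {u v : SL25} (h : (lift u).1 = (lift v).1) : IsConj u v := by
  have key : ∀ u : SL25, ∃ g : SL25, ∀ i j, (g * u) i j =
      (!![(classRep (lift u).1).1, (classRep (lift u).1).2.1; (classRep (lift u).1).2.2.1,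
        (classRep (lift u).1).2.2.2] : Matrix (Fin 2) (Fin 2) (ZMod 5)) i 0 * g 0 j +
      (!![(classRep (lift u).1).1, (classRep (lift u).1).2.1; (classRep (lift u).1).2.2.1,
        (classRep (lift u).1).2.2.2] : Matrix (Fin 2) (Fin 2) (ZMod 5)) i 1 * g 1 j := by
    intro u
    obtain ⟨x, y, hdet, h0, h1, h2, h3⟩ := exists_conj_classRep _ _ _ _ (det_entries u)
    refine ⟨mk x y _ _ hdet, fun i j => ?_⟩
    rw [mul_apply]
    fin_cases i <;> fin_cases j
    exacts [h0, h1, h2, h3]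
  obtain ⟨g, hg⟩ := key u
  obtain ⟨k, hk⟩ := key v
  rw [h] at hg
  set R : Matrix (Fin 2) (Fin 2) (ZMod 5) :=
    !![(classRep (lift v).1).1, (classRep (lift v).1).2.1; (classRep (lift v).1).2.2.1,
      (classRep (lift v).1).2.2.2]
  have hgR : (g * u : SL25).1 = R * g.1 := by
    ext i j
    rw [Matrix.mul_apply, Fin.sum_univ_two]
    exact hg i j
  have hkR : (k * v : SL25).1 = R * k.1 := by
    ext i j
    rw [Matrix.mul_apply, Fin.sum_univ_two]
    exact hk i j
  have h1 : (g * u * g⁻¹ : SL25).1 = R := by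
    rw [Matrix.SpecialLinearGroup.coe_mul, hgR, mul_assoc, ← Matrix.SpecialLinearGroup.coe_mul,
      mul_inv_cancel, Matrix.SpecialLinearGroup.coe_one, mul_one]
  have h2 : (k * v * k⁻¹ : SL25).1 = R := by
    rw [Matrix.SpecialLinearGroup.coe_mul, hkR, mul_assoc, ← Matrix.SpecialLinearGroup.coe_mul,
      mul_inv_cancel, Matrix.SpecialLinearGroup.coe_one, mul_one]
  have h3 : g * u * g⁻¹ = k * v * k⁻¹ := Subtype.ext (h1.trans h2.symm)
  exact (isConj_iff.2 ⟨g, rfl⟩).trans (h3 ▸ (isConj_iff.2 ⟨k, rfl⟩ : IsConj v _).symm)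

theorem isConj_of_re_eq {u v : SL25} (h : (quat u).re = (quat v).re) : IsConj u v := by
  refine isConj_of_lift_eq (GoldInt.toReal_injective ?_)
  have h' : GoldInt.toReal (lift u).1 / 2 = GoldInt.toReal (lift v).1 / 2 := h
  linarith

/-- Inversion is quaternionic conjugation and keeps the real part. Hence all complex characters are
real-valued and `symClass` is a single conjugacy class. -/
theorem isConj_inv (u : SL25) : IsConj u u⁻¹ :=
  isConj_of_re_eq (by rw [← star_quat, Quaternion.re_star])

theorem symClass_eq (u : SL25) : symClass u = (ConjClasses.mk u).carrier := by
  ext v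
  rw [ConjClasses.mem_carrier_iff_mk_eq, ConjClasses.mk_eq_mk_iff_isConj, isConj_comm]
  exact or_iff_left_of_imp fun h => (isConj_inv u).trans h

theorem inner_quat (u v : SL25) : ⟪quat u, quat v⟫_ℝ = (quat (u⁻¹ * v)).re := by
  rw [Quaternion.inner_def, quat_mul, ← star_quat, Quaternion.re_mul, Quaternion.re_mul]
  simp

/-- An isometry of the quaternions that permutes the vertices of the 600-cell. -/
theorem mem_cell600Group {g : ℍ ≃ₗᵢ[ℝ] ℍ} (f : SL25 ≃ SL25) (h : ∀ u, g (quat u) = quat (f u)) :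
    g ∈ cell600Group := by
  change g '' cell600 = cell600
  ext q
  constructor
  · rintro ⟨q, hq, rfl⟩
    obtain ⟨u, hu⟩ := vertexEquiv.surjective ⟨q, hq⟩
    have : q = quat u := (congrArg Subtype.val hu).symm
    rw [this, h]
    exact quat_mem _
  · intro hq
    obtain ⟨u, hu⟩ := vertexEquiv.surjective ⟨q, hq⟩
    have : q = quat u := (congrArg Subtype.val hu).symm
    exact ⟨quat (f.symm u), quat_mem _, by rw [h, f.apply_symm_apply, this]⟩

/-- Multiplication with vertices of the 600-cell from the left and from the right. -/
def mulIsometry (a b : SL25) : ℍ ≃ₗᵢ[ℝ] ℍ where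
  toFun := fun q => quat a * q * quat b
  invFun := fun q => quat a⁻¹ * q * quat b⁻¹
  map_add' := fun p q => by rw [mul_add, add_mul]
  map_smul' := fun c q => by simp
  left_inv := fun q => by
    change quat a⁻¹ * (quat a * q * quat b) * quat b⁻¹ = q
    rw [← mul_assoc, ← mul_assoc, ← quat_mul, mul_assoc, ← quat_mul, inv_mul_cancel,
      mul_inv_cancel, quat_one, one_mul, mul_one]
  right_inv := fun q => by
    change quat a * (quat a⁻¹ * q * quat b⁻¹) * quat b = q
    rw [← mul_assoc, ← mul_assoc, ← quat_mul, mul_assoc, ← quat_mul, inv_mul_cancel,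
      mul_inv_cancel, quat_one, one_mul, mul_one]
  norm_map' := fun q => by
    change ‖quat a * q * quat b‖ = ‖q‖
    rw [norm_mul, norm_mul, norm_quat, norm_quat, one_mul, mul_one]

/-- The element of the group of the 600-cell given by multiplication from both sides. -/
def mulElement (a b : SL25) : cell600Group :=
  ⟨mulIsometry a b, mem_cell600Group ((Equiv.mulLeft a).trans (Equiv.mulRight b)) fun u => by
    change quat a * quat u * quat b = quat (a * u * b)
    rw [quat_mul, quat_mul]⟩

theorem mulElement_smul (a b u : SL25) :
    mulElement a b • vertexEquiv u = vertexEquiv (a * u * b) := by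
  refine Subtype.ext ?_
  change quat a * quat u * quat b = quat (a * u * b)
  rw [quat_mul, quat_mul]

theorem translate_eq {G : Type*} [Group G] {a u v u' v' : G}
    (h : a * (u⁻¹ * v) * a⁻¹ = u'⁻¹ * v') :
    u' * a * u⁻¹ * u * a⁻¹ = u' ∧ u' * a * u⁻¹ * v * a⁻¹ = v' := by
  rw [eq_inv_mul_iff_mul_eq] at h
  rw [← h]
  exact ⟨by group, by group⟩

/-- An isometry preserves `⟪quat u, quat v⟫`, the real part of `quat (u⁻¹ * v)`, and thereby the
conjugacy class. Conversely, two-sided multiplications already realize every conjugation. -/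
theorem isGroupModel_cell600 : IsGroupModel cell600Group vertexEquiv := by
  intro u v u' v'
  rw [symClass_eq, ConjClasses.mem_carrier_iff_mk_eq, ConjClasses.mk_eq_mk_iff_isConj]
  constructor
  · rintro ⟨g, hu, hv⟩
    have hu' : g.1 (quat u) = quat u' := congrArg Subtype.val hu
    have hv' : g.1 (quat v) = quat v' := congrArg Subtype.val hv
    refine isConj_of_re_eq ?_
    rw [← inner_quat, ← inner_quat, ← hu', ← hv', LinearIsometryEquiv.inner_map_map]
  · intro h
    obtain ⟨a, ha⟩ := isConj_iff.1 h.symm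
    obtain ⟨h1, h2⟩ := translate_eq ha
    refine ⟨mulElement (u' * a * u⁻¹) a⁻¹, ?_, ?_⟩
    · rw [mulElement_smul, h1]
    · rw [mulElement_smul, h2]

theorem conj_eq_self (φ : IrrChar ℂ SL25) (u : SL25) : starRingEnd ℂ (φ u) = φ u := by
  obtain ⟨g, hg⟩ := isConj_iff.1 (isConj_inv u)
  rw [← φ.inv_apply, ← hg, φ.conj_apply]

theorem exists_realizations : ∃ e : SL25 ≃ cell600,
    (∀ u v : SL25, (e (u * v) : ℍ) = (e u : ℍ) * (e v : ℍ)) ∧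
    Set.BijOn (fun c : ConjClasses SL25 => e '' c.carrier) Set.univ
      (layers cell600Group (e 1)) ∧
    ∃ A : IrrChar ℂ SL25 → PureRealization cell600Group cell600,
      Function.Bijective (fun φ => (A φ).toClass) ∧
      ∀ φ : IrrChar ℂ SL25,
        ((A φ).1.dim : ℂ) = φ 1 ^ 2 ∧
        ∀ u : SL25, ((A φ).1.cosine (e 1) (e u) : ℂ) = φ u / φ 1 := by
  have H := isGroupModel_cell600
  obtain ⟨E, hE⟩ := IrrChar.exists_equiv_real conj_eq_self
  have himage : ∀ u : SL25, vertexEquiv '' (ConjClasses.mk u).carrier =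
      layer cell600Group (vertexEquiv 1) (vertexEquiv u) := fun u => by
    rw [H.layer_eq, symClass_eq]
  refine ⟨vertexEquiv, quat_mul, ⟨?_, ?_, ?_⟩, fun φ => H.pure (E φ),
    H.bijective_toClass.comp E.bijective, fun φ => ⟨?_, fun u => ?_⟩⟩
  · intro c _
    obtain ⟨u, rfl⟩ := ConjClasses.exists_rep c
    exact ⟨vertexEquiv u, (himage u).symm⟩
  · intro c _ d _ h
    have hcd : c.carrier = d.carrier := vertexEquiv.injective.image_injective h
    obtain ⟨u, rfl⟩ := ConjClasses.exists_rep c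
    have hu : u ∈ (ConjClasses.mk u).carrier := ConjClasses.mem_carrier_mk
    change u ∈ (ConjClasses.mk u).carrier at hu
    rw [show (ConjClasses.mk u).carrier = d.carrier from hcd] at hu
    exact ConjClasses.mem_carrier_iff_mk_eq.1 hu
  · rintro _ ⟨ω, rfl⟩
    obtain ⟨u, rfl⟩ := vertexEquiv.surjective ω
    exact ⟨ConjClasses.mk u, trivial, himage u⟩
  · rw [← IrrChar.card_mul_idem_one_of_real (hE φ) (conj_eq_self φ), ← H.dim_pure (E φ)]
    simp
  · rw [H.cosine_pure, IrrChar.idem_div_of_isConstituent (hE φ),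
      Complex.conj_eq_iff_re.1 (conj_eq_self φ u)]

end SL25

end

/-- The realizations of the wreath product. -/
theorem wreath_realizations (U : Type*) [Group U] [Fintype U] :
      let G := U ≀ᵣ C2
      let Ω := G ⧸ diagC2 U
      let α : Ω := ((1 : G) : Ω)
      Set.BijOn (fun S : Set U => {ω : Ω | ∃ g : G, ω = g • α ∧ invMul g ∈ S})
        (Set.range (symClass (U := U))) (layers G α) ∧
      (∀ B : PureRealization G Ω, Module.finrank ℝ (B.1.wythoffSpace α) = 1) ∧
      ∃ A : IrrChar ℝ U → PureRealization G Ω,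
        Function.Bijective (fun σ => (A σ).toClass) ∧
        (∀ (σ : IrrChar ℝ U) (φ : IrrChar ℂ U), IsConstituent φ σ →
          ((∀ u, (starRingEnd ℂ) (φ u) = φ u) → ((A σ).1.dim : ℂ) = φ 1 ^ 2) ∧
          ((¬ ∀ u, (starRingEnd ℂ) (φ u) = φ u) → ((A σ).1.dim : ℂ) = 2 * φ 1 ^ 2) ∧
          ∀ g : G, ((A σ).1.cosine α (g • α) : ℂ) = ((φ (invMul g)).re : ℂ) / φ 1) ∧
        LinearIndependent ℝ (fun σ => (A σ).1.innerMatrix) ∧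
        realizationCone G Ω =
          (PointedCone.hull ℝ (Set.range fun σ => (A σ).1.innerMatrix) : Set (Matrix Ω Ω ℝ)) := by
  intro G Ω α
  have H := isGroupModel_wreath U
  have hα : α = wreathEquiv U 1 :=
    congrArg _ (RegularWreathProduct.ext (funext fun i => by simp [wr]) rfl :
      (1 : U ≀ᵣ C2) = wr 1 1 1)
  have hg : ∀ x y s, (wr x y s : G) • α = wreathEquiv U (y * x⁻¹) := by
    intro x y s
    rw [← mk_wr x y s]
    exact congrArg _ (mul_one (wr x y s : G))
  rw [hα] at hg ⊢
  -- The coset of `(x, y) s` is labelled by `y * x⁻¹`, a conjugate of `x⁻¹ * y`.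
  have hsym : ∀ x y u : U, x⁻¹ * y ∈ symClass u ↔ y * x⁻¹ ∈ symClass u := by
    intro x y u
    have hc : IsConj (x⁻¹ * y) (y * x⁻¹) := isConj_iff.2 ⟨x, by group⟩
    exact or_congr ⟨fun h => h.trans hc, fun h => h.trans hc.symm⟩
      ⟨fun h => h.trans hc, fun h => h.trans hc.symm⟩
  have himage : ∀ u : U, {ω : Ω | ∃ g : G, ω = g • wreathEquiv U 1 ∧ invMul g ∈ symClass u} =
      layer G (wreathEquiv U 1) (wreathEquiv U u) := by
    intro u
    rw [H.layer_eq]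
    ext ω
    constructor
    · rintro ⟨g, rfl, hu⟩
      obtain ⟨x, y, s, rfl⟩ := wr_surjective g
      rw [invMul_wr, hsym] at hu
      rw [hg]
      exact Set.mem_image_of_mem _ hu
    · rintro ⟨v, hv, rfl⟩
      refine ⟨wr 1 v 1, ?_, ?_⟩
      · rw [hg, inv_one, mul_one]
      · rwa [invMul_wr, inv_one, one_mul]
  refine ⟨⟨?_, ?_, ?_⟩, fun B => H.finrank_wythoffSpace B.2, H.pure, H.bijective_toClass,
    fun σ φ hφ => ⟨fun h => ?_, fun h => ?_, fun g => ?_⟩, H.linearIndependent_innerMatrix,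
    H.realizationCone_eq⟩
  · rintro _ ⟨u, rfl⟩
    exact ⟨wreathEquiv U u, (himage u).symm⟩
  · rintro _ ⟨u, rfl⟩ _ ⟨v, rfl⟩ h
    change {ω : Ω | ∃ g : G, ω = g • wreathEquiv U 1 ∧ invMul g ∈ symClass u} =
      {ω : Ω | ∃ g : G, ω = g • wreathEquiv U 1 ∧ invMul g ∈ symClass v} at h
    rw [himage, himage, H.layer_eq, H.layer_eq] at h
    exact (wreathEquiv U).injective.image_injective h
  · rintro _ ⟨ω, rfl⟩
    obtain ⟨u, rfl⟩ := (wreathEquiv U).surjective ω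
    exact ⟨symClass u, ⟨u, rfl⟩, himage u⟩
  · rw [← IrrChar.card_mul_idem_one_of_real hφ h, ← H.dim_pure σ]
    simp
  · rw [← IrrChar.card_mul_idem_one_of_not_real hφ h, ← H.dim_pure σ]
    simp
  · obtain ⟨x, y, s, rfl⟩ := wr_surjective g
    rw [hg, H.cosine_pure, ← IrrChar.idem_div_of_isConstituent hφ, invMul_wr,
      σ.idem_isSymmClassFun.mul_comm]

theorem mainTheorem9 :
    (∃ e : SL25 ≃ cell600,
      (∀ u v : SL25, (e (u * v) : ℍ) = (e u : ℍ) * (e v : ℍ)) ∧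
      Set.BijOn (fun c : ConjClasses SL25 => e '' c.carrier) Set.univ
        (layers cell600Group (e 1)) ∧
      ∃ A : IrrChar ℂ SL25 → PureRealization cell600Group cell600,
        Function.Bijective (fun φ => (A φ).toClass) ∧
        ∀ φ : IrrChar ℂ SL25,
          ((A φ).1.dim : ℂ) = φ 1 ^ 2 ∧
          ∀ u : SL25, ((A φ).1.cosine (e 1) (e u) : ℂ) = φ u / φ 1) ∧
    (∀ (U : Type*) [Group U] [Fintype U],
      let G := U ≀ᵣ C2
      let Ω := G ⧸ diagC2 U
      let α : Ω := ((1 : G) : Ω)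
      Set.BijOn (fun S : Set U => {ω : Ω | ∃ g : G, ω = g • α ∧ invMul g ∈ S})
        (Set.range (symClass (U := U))) (layers G α) ∧
      (∀ B : PureRealization G Ω, Module.finrank ℝ (B.1.wythoffSpace α) = 1) ∧
      ∃ A : IrrChar ℝ U → PureRealization G Ω,
        Function.Bijective (fun σ => (A σ).toClass) ∧
        (∀ (σ : IrrChar ℝ U) (φ : IrrChar ℂ U), IsConstituent φ σ →
          ((∀ u, (starRingEnd ℂ) (φ u) = φ u) → ((A σ).1.dim : ℂ) = φ 1 ^ 2) ∧
          ((¬ ∀ u, (starRingEnd ℂ) (φ u) = φ u) → ((A σ).1.dim : ℂ) = 2 * φ 1 ^ 2) ∧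
          ∀ g : G, ((A σ).1.cosine α (g • α) : ℂ) = ((φ (invMul g)).re : ℂ) / φ 1) ∧
        LinearIndependent ℝ (fun σ => (A σ).1.innerMatrix) ∧
        realizationCone G Ω =
          (PointedCone.hull ℝ (Set.range fun σ => (A σ).1.innerMatrix) : Set (Matrix Ω Ω ℝ))) := by
  exact ⟨SL25.exists_realizations, fun U _ _ => wreath_realizations U⟩
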